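/- Let $\alpha>0$ be irrational with continued fraction expansion $\alpha=[a_0;a_1,a_2,\dots]$ and convergents $p_n/q_n=[a_0;a_1,\dots,a_n]$ in lowest terms. Write $\{y\}\in[0,1)$ for the fractional part of a real number $y$ and $\|y\|$ for its distance to the nearest integer. Let $n_1<n_2<\cdots$ be positive integers such that the following hold: 1. all $n_k$ are even; 2. $\sum_{k\ge 1}2\{q_{n_k}\alpha\}<\min\left(\frac{\alpha}{4},\,1-\frac{\alpha}{4}\right)$; 3. $1+\sum_{k=1}^{\ell}2q_{n_k}<q_{n_\ell+1}$ for all $\ell\ge 1$; 4. $a_{n_\ell+1}\to\infty$ as $\ell\to\infty$; 5. $a_n=o(\log\log q_n)$ and $a_{n+1}=o(\log\log q_n)$ as $n\to\infty$; 6. $\sum_{k\ge1}a_{n_k+1}^{-1}=\infty$; 7. $\sum_{i=1}^{n+1}a_i=O(\log q_n)$ as $n\to\infty$; 8. $\log q_{n_{k-1}+1}=o(\log q_{n_k})$ as $k\to\infty$; 9. $a_{n_k}=2$ and $a_{n_k-1}=2$ for all $k$. Let $S^1=\mathbb{R}/\mathbb{Z}$ and $\mathbb{Z}_2=\mathbb{Z}/2\mathbb{Z}$,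 let $J\subset S^1$ be the image of $\left[0,\sum_{k\ge1}2\{q_{n_k}\alpha\}\right)$, let $x_\infty=\alpha-\sum_{k\ge1}\|q_{n_k-1}\alpha\|$, and let $\chi_A$ denote the indicator function of a set $A$. Then the skew product $$\hat T:S^1\times\mathbb{Z}_2\times\mathbb{Z}_2\to S^1\times\mathbb{Z}_2\times\mathbb{Z}_2,\qquad \hat T(x,i,j)=\bigl(x+\alpha,\; i+\chi_J(x+\alpha),\; j+\chi_{J+x_\infty}(x+\alpha)\bigr)$$ is uniquely ergodic, i.e. it has exactly one invariant Borel probability measure. -/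

import Mathlib

open Filter Asymptotics MeasureTheory

noncomputable section

/-- The `i`-th term `a_i` of the continued fraction expansion `α = a_0 + 1/(a_1 + 1/(a_2 + ⋯))`
of an irrational number `α`. The sequence `partDens` of Mathlib starts at `a_1`; for irrational `α`
it never terminates, so the default value `0` is not used. -/
def cfTerm (α : ℝ) : ℕ → ℝ
  | 0 => (GenContFract.of α).h
  | i + 1 => ((GenContFract.of α).partDens.get? i).getD 0

/-- The denominator `q_i` of the `i`-th convergent `p_i / q_i = [a_0; a_1, …, a_i]` of `α`
(so `q_0 = 1`, `q_1 = a_1`). -/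
def cfDen (α : ℝ) (i : ℕ) : ℝ := (GenContFract.of α).dens i

/-- The distance `d(x, x + t)` on the circle `S¹ = ℝ/ℤ`, i.e. the distance from the real number `t`
to the nearest integer. -/
def circleDist (t : ℝ) : ℝ := ‖(t : UnitAddCircle)‖

/-- The length `|J| = ∑_k 2 {q_{n_k} α}` of the interval `J`. The sequence `n` is indexed
from `0`, so `n 0 < n 1 < ⋯` are the numbers called `n_1 < n_2 < ⋯` in the usual notation. -/
def lengthJ (α : ℝ) (n : ℕ → ℕ) : ℝ := ∑' k, 2 * Int.fract (cfDen α (n k) * α)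

/-- The standing assumptions on the rotation number `α` and on the subsequence `n_k` of the
positive integers. -/
structure IsAdmissible (α : ℝ) (n : ℕ → ℕ) : Prop where
  pos : 0 < α
  irrational : Irrational α
  strictMono : StrictMono n
  index_pos : ∀ k, 0 < n k
  even : ∀ k, Even (n k)
  length_lt : lengthJ α n < min (α / 4) (1 - α / 4)
  sum_den_lt : ∀ l, 1 + ∑ k ∈ Finset.range (l + 1), 2 * cfDen α (n k) < cfDen α (n l + 1)
  tendsto_term : Tendsto (fun l => cfTerm α (n l + 1)) atTop atTop
  term_isLittleO : (fun i => cfTerm α i) =o[atTop] fun i => Real.log (Real.log (cfDen α i))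
  term_succ_isLittleO :
    (fun i => cfTerm α (i + 1)) =o[atTop] fun i => Real.log (Real.log (cfDen α i))
  sum_inv_eq_top :
    Tendsto (fun K => ∑ k ∈ Finset.range K, (cfTerm α (n k + 1))⁻¹) atTop atTop
  sum_term_isBigO :
    (fun m => ∑ i ∈ Finset.Icc 1 (m + 1), cfTerm α i) =O[atTop] fun m => Real.log (cfDen α m)
  log_den_isLittleO :
    (fun k => Real.log (cfDen α (n k + 1))) =o[atTop] fun k => Real.log (cfDen α (n (k + 1)))
  term_eq_two : ∀ k, cfTerm α (n k) = 2 ∧ cfTerm α (n k - 1) = 2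

/-- The interval `J = [0, |J|)`, as a subset of the circle. -/
def intervalJ (α : ℝ) (n : ℕ → ℕ) : Set UnitAddCircle :=
  (fun t : ℝ => (t : UnitAddCircle)) '' Set.Ico 0 (lengthJ α n)

/-- The point `x_∞ = α - ∑_k d(0, R^{q_{n_k - 1}} 0)`, where `R` is the rotation by `α`. -/
def xInfty (α : ℝ) (n : ℕ → ℕ) : ℝ := α - ∑' k, circleDist (cfDen α (n k - 1) * α)

/-- The translate `J + x_∞` on the circle. -/
def intervalJTranslate (α : ℝ) (n : ℕ → ℕ) : Set UnitAddCircle :=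
  (fun y => y + (xInfty α n : UnitAddCircle)) '' intervalJ α n

/-- The skew product `(x, i, j) ↦ (x + α, i + χ_J(x + α), j + χ_{J + x_∞}(x + α))`. -/
def hatT (α : ℝ) (n : ℕ → ℕ) (p : UnitAddCircle × ZMod 2 × ZMod 2) :
    UnitAddCircle × ZMod 2 × ZMod 2 :=
  (p.1 + (α : UnitAddCircle),
    p.2.1 + (intervalJ α n).indicator (fun _ => 1) (p.1 + (α : UnitAddCircle)),
    p.2.2 + (intervalJTranslate α n).indicator (fun _ => 1) (p.1 + (α : UnitAddCircle)))

/-- A transformation is uniquely ergodic if it has exactly one invariant probability measure. -/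
def IsUniquelyErgodic {X : Type*} [MeasurableSpace X] (T : X → X) : Prop :=
  ∃! μ : Measure X, IsProbabilityMeasure μ ∧ MeasurePreserving T μ μ

end

/-!
Write `e` for the nontrivial character of `ℤ/2ℤ`. A set that is invariant under the skew product
has, for every character of the fibre, a Fourier coefficient `u` on the circle which satisfies
`u x = s x * u (x - α)`, where the sign `s` is `e ∘ χ_J`, `e ∘ χ_{J + x_∞}` or their product when
the character is nontrivial. If these three equations have only the solution `u = 0` almost
everywhere, then invariant sets come from the irrational rotation, so the product measure
`skewMeasure` is ergodic (`ergodic_hatT`). An arbitrary invariant probability measure projects to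
an invariant measure of the rotation, hence to Haar measure, hence is absolutely continuous with
respect to `skewMeasure` (`absolutelyContinuous_skewMeasure`), hence equal to it.

Only the product sign `cocycleSign` needs work: from a solution `u` for `J` alone one obtains the
solution `u x * u (x - x_∞)` for the product.

Since `2 {q_{n_k} α}` is twice a return angle of the rotation, the sign of the first `l` pieces of
`J` is a coboundary with an explicit transfer function `transferSign`, a product of signs
`pieceSign` of unions of `q_{n_k}` short arcs. With the translate by `x_∞` this gives the transfer
functions `crossSign α q n l`, whose coboundaries approximate `cocycleSign`. Two facts about them
contradict each other if `cocycleSign` is a coboundary (`AdmissibleData.not_coboundary`).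

* If `u` is a transfer function with values `± 1`, then `u` times `crossSign α q n l` is almost
  invariant under `q_{n_l}` steps of the rotation, because the remaining part of `J` has length
  `o(1 / q_{n_l})`, and under translations by `2 / q_{n_l}`, because it has `o(q_{n_l})` sign
  changes apart from those of `u`. These motions together reach every translation of the circle,
  so the product is almost constant, and `crossSign α q n l` and `crossSign α q n L` are strongly
  correlated for large `l` and `L` (`ContFractData.false_of_sign_cocycle`).
* For fixed `l` the correlation of `crossSign α q n l` and `crossSign α q n L` tends to `0` as
  `L → ∞` (`ContFractData.tendsto_integral_mul_zero`). Passing from `L` to `L + 1` multiplies by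
  `stepSign`, which varies on a much finer scale and is therefore almost independent of what came
  before. As `x_∞` is very close to the orbit point `translateTime q n L • α` and
  `translateTime q n L` is a definite proportion of `q_{n_L}`, telescoping
  (`arcProd_mul_translate`) shows that `stepSign` is `-1` on a set of measure at least a constant
  over `a_{n_L + 1}`. The sum of these measures diverges.

All estimates use one quantity, the `L¹` distance `transDist f t` between `f` and its translate
by `t`.
-/

/-! ### Continued fractions of irrational numbers -/

theorem not_terminatedAt_of_irrational {α : ℝ} (hα : Irrational α) (i : ℕ) :
    ¬(GenContFract.of α).TerminatedAt i := fun h =>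
  let ⟨r, hr⟩ := (GenContFract.terminates_iff_rat α).1 ⟨i, h⟩
  hα ⟨r, hr.symm⟩

theorem exists_get?_of_irrational {α : ℝ} (hα : Irrational α) (i : ℕ) :
    ∃ a : ℕ, 1 ≤ a ∧ (GenContFract.of α).s.get? i = some ⟨1, (a : ℝ)⟩ ∧
      cfTerm α (i + 1) = a := by
  obtain ⟨⟨x, y⟩, hgp⟩ := Option.ne_none_iff_exists'.1 (not_terminatedAt_of_irrational hα i)
  obtain ⟨h1, z, hz⟩ := GenContFract.of_partNum_eq_one_and_exists_int_partDen_eq hgp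
  simp only at h1 hz
  have hden := GenContFract.partDen_eq_s_b hgp
  have hone := GenContFract.of_one_le_get?_partDen hden
  simp only at hone hden
  have hz1 : (1 : ℤ) ≤ z := by rw [hz] at hone; exact_mod_cast hone
  lift z to ℕ using by lia
  refine ⟨z, by exact_mod_cast hz1, by rw [hgp, h1, hz]; simp, ?_⟩
  simp [cfTerm, hden, hz]

/-- The terms, numerators and denominators of the continued fraction expansion of `α`, as
integers, together with the relations between them that are used below. -/
structure ContFractData (α : ℝ) (a q : ℕ → ℕ) (p : ℕ → ℤ) : Prop where
  den_eq : ∀ i, cfDen α i = q i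
  term_eq : ∀ i, cfTerm α (i + 1) = a (i + 1)
  one_le_term : ∀ i, 1 ≤ a (i + 1)
  den_zero : q 0 = 1
  den_one : q 1 = a 1
  den_succ : ∀ i, q (i + 2) = a (i + 2) * q (i + 1) + q i
  det : ∀ i, p (i + 1) * q i - p i * q (i + 1) = (-1) ^ i
  abs_sub_le : ∀ i, |(q i : ℝ) * α - p i| ≤ 1 / q (i + 1)

theorem exists_contFractData {α : ℝ} (hα : Irrational α) : ∃ a q p, ContFractData α a q p := by
  choose b hb1 hb hbt using exists_get?_of_irrational hα
  have hnum : ∀ i, ∃ z w : ℤ, (GenContFract.of α).nums i = z ∧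
      (GenContFract.of α).nums (i + 1) = w := by
    intro i
    induction i with
    | zero =>
      refine ⟨⌊α⌋, b 0 * ⌊α⌋ + 1, ?_, ?_⟩
      · rw [GenContFract.zeroth_num_eq_h, GenContFract.of_h_eq_floor]
      · rw [GenContFract.first_num_eq (hb 0), GenContFract.of_h_eq_floor]; push_cast; ring
    | succ i ih =>
      obtain ⟨z, w, hz, hw⟩ := ih
      exact ⟨w, b (i + 1) * w + z, hw, by
        rw [GenContFract.nums_recurrence (hb (i + 1)) hz hw]; push_cast; ring⟩
  have hden : ∀ i, ∃ z w : ℕ, 1 ≤ z ∧ 1 ≤ w ∧ (GenContFract.of α).dens i = z ∧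
      (GenContFract.of α).dens (i + 1) = w := by
    intro i
    induction i with
    | zero =>
      refine ⟨1, b 0, le_rfl, hb1 0, ?_, ?_⟩
      · rw [GenContFract.zeroth_den_eq_one]; simp
      · rw [GenContFract.first_den_eq (hb 0)]
    | succ i ih =>
      obtain ⟨z, w, hz1, hw1, hz, hw⟩ := ih
      exact ⟨w, b (i + 1) * w + z, hw1, by lia, hw, by
        rw [GenContFract.dens_recurrence (hb (i + 1)) hz hw]; push_cast; ring⟩
  choose p _ hp _ using hnum
  choose q _ hq1 _ hq _ using hden
  refine ⟨fun i => b (i - 1), q, p, hq, fun i => by simp [hbt i], fun i => hb1 i, ?_, ?_, ?_, ?_, ?_⟩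
  · exact_mod_cast (hq 0).symm.trans GenContFract.zeroth_den_eq_one
  · have := (hq 1).symm.trans (GenContFract.first_den_eq (hb 0))
    simp only at this
    exact_mod_cast this
  · intro i
    have := GenContFract.dens_recurrence (hb (i + 1)) (hq i) (hq (i + 1))
    rw [hq (i + 2)] at this
    simp only [one_mul] at this
    simp only [Nat.add_one_sub_one]
    exact_mod_cast this
  · intro i
    have h := (SimpContFract.of α).determinant (n := i) (not_terminatedAt_of_irrational hα i)
    simp only [SimpContFract.of] at h
    rw [hq i, hq (i + 1), hp i, hp (i + 1)] at h
    have h' : p i * (q (i + 1) : ℤ) - q i * p (i + 1) = (-1) ^ (i + 1) := by exact_mod_cast h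
    rw [pow_succ] at h'
    linarith
  · intro i
    have h := GenContFract.abs_sub_convs_le (not_terminatedAt_of_irrational hα i)
    rw [GenContFract.conv_eq_num_div_den, hq i, hq (i + 1), hp i] at h
    have hpos : (0 : ℝ) < q i := by exact_mod_cast hq1 i
    calc |(q i : ℝ) * α - p i| = q i * |α - p i / q i| := by
          rw [← abs_of_pos hpos, ← abs_mul, abs_of_pos hpos]; congr 1; field_simp
      _ ≤ q i * (1 / (q i * q (i + 1))) := by gcongr
      _ = 1 / q (i + 1) := by field_simp

namespace ContFractData

variable {α : ℝ} {a q : ℕ → ℕ} {p : ℕ → ℤ}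

theorem den_pos (h : ContFractData α a q p) : ∀ i, 0 < q i
  | 0 => by simp [h.den_zero]
  | 1 => by rw [h.den_one]; exact h.one_le_term 0
  | i + 2 => by
    rw [h.den_succ]
    have := h.den_pos i
    positivity

theorem den_mono (h : ContFractData α a q p) : Monotone q := by
  refine monotone_nat_of_le_succ fun i => ?_
  cases i with
  | zero => have := h.den_pos 1; simp [h.den_zero]; lia
  | succ i =>
    rw [h.den_succ]
    have := Nat.mul_le_mul_right (q (i + 1)) (h.one_le_term (i + 1))
    simp only [one_mul, add_assoc] at this
    exact this.trans (Nat.le_add_right _ _)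

theorem two_mul_den_le (h : ContFractData α a q p) (i : ℕ) : 2 * q i ≤ q (i + 2) := by
  rw [h.den_succ]
  have := Nat.mul_le_mul_right (q (i + 1)) (h.one_le_term (i + 1))
  simp only [one_mul, add_assoc] at this
  have := h.den_mono (Nat.le_succ i)
  simp only [Nat.succ_eq_add_one] at this
  lia

theorem two_pow_mul_den_le (h : ContFractData α a q p) (i j : ℕ) :
    2 ^ j * q i ≤ q (i + 2 * j) := by
  induction j with
  | zero => simp
  | succ j ih =>
    calc 2 ^ (j + 1) * q i = 2 * (2 ^ j * q i) := by ring
      _ ≤ 2 * q (i + 2 * j) := by lia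
      _ ≤ q (i + 2 * (j + 1)) := h.two_mul_den_le _

theorem term_mul_den_le (h : ContFractData α a q p) (i : ℕ) :
    a (i + 1) * q i ≤ q (i + 1) := by
  cases i with
  | zero => simp [h.den_zero, h.den_one]
  | succ i => rw [h.den_succ]; exact Nat.le_add_right _ _

theorem den_succ_le (h : ContFractData α a q p) (i : ℕ) :
    q (i + 1) ≤ (a (i + 1) + 1) * q i := by
  cases i with
  | zero => simp [h.den_zero, h.den_one]
  | succ i =>
    rw [h.den_succ, add_mul, one_mul]
    exact Nat.add_le_add_left (h.den_mono (Nat.le_succ i)) _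

theorem isCoprime (h : ContFractData α a q p) (i : ℕ) : IsCoprime (p i) (q i : ℤ) := by
  have hd := h.det i
  rcases neg_one_pow_eq_or ℤ i with h1 | h1 <;> rw [h1] at hd
  · exact ⟨-q (i + 1), p (i + 1), by linarith⟩
  · exact ⟨q (i + 1), -p (i + 1), by linarith⟩

/-- The determinant formula, written in terms of the signed errors `q_i α - p_i`. -/
theorem error_det (h : ContFractData α a q p) (i : ℕ) :
    (q (i + 1) : ℝ) * (q i * α - p i) - q i * (q (i + 1) * α - p (i + 1)) = (-1) ^ i := by
  have := h.det i
  have h' : (p (i + 1) : ℝ) * q i - p i * q (i + 1) = (-1) ^ i := by exact_mod_cast this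
  linarith

theorem den_mul_error_le (h : ContFractData α a q p) (i : ℕ) :
    q i * |(q (i + 1) : ℝ) * α - p (i + 1)| ≤ 1 / 2 := by
  have h2 : (2 : ℝ) * q i ≤ q (i + 2) := by exact_mod_cast h.two_mul_den_le i
  have hp : (0 : ℝ) < q (i + 2) := by exact_mod_cast h.den_pos _
  calc q i * |(q (i + 1) : ℝ) * α - p (i + 1)| ≤ q i * (1 / q (i + 2)) := by
        gcongr; exact h.abs_sub_le (i + 1)
    _ ≤ 1 / 2 := by rw [mul_one_div, div_le_div_iff₀ hp two_pos]; linarith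

/-- The signed errors `q_i α - p_i` alternate in sign and are comparable to `1 / q_{i+1}`. -/
theorem error_lower (h : ContFractData α a q p) (i : ℕ) :
    1 / (2 * q (i + 1) : ℝ) ≤ (-1) ^ i * (q i * α - p i) := by
  have hp : (0 : ℝ) < q (i + 1) := by exact_mod_cast h.den_pos _
  have h1 := h.error_det i
  have h2 := h.den_mul_error_le i
  rw [div_le_iff₀ (by positivity)]
  have h3 : q i * |(q (i + 1) : ℝ) * α - p (i + 1)| = |q i * ((q (i + 1) : ℝ) * α - p (i + 1))| := by
    rw [abs_mul, Nat.abs_cast]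
  rw [h3] at h2
  have h4 := abs_le.1 h2
  rcases neg_one_pow_eq_or ℝ i with hs | hs <;> rw [hs] at h1 ⊢ <;> linarith

end ContFractData

/-! ### Translates of bounded functions on the circle -/

instance isProbabilityMeasure_volume_unitAddCircle :
    IsProbabilityMeasure (volume : Measure UnitAddCircle) :=
  ⟨by simp⟩

/-- A measurable function on the circle with values in `[-1, 1]`. -/
structure IsUnitBounded (f : UnitAddCircle → ℝ) : Prop where
  measurable : Measurable f
  abs_le : ∀ x, |f x| ≤ 1

/-- The `L¹` distance between `f` and its translate by `t`. -/
noncomputable def transDist (f : UnitAddCircle → ℝ) (t : UnitAddCircle) : ℝ :=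
  ∫ x, |f (x + t) - f x|

namespace IsUnitBounded

variable {f g : UnitAddCircle → ℝ}

theorem integrable (hf : IsUnitBounded f) : Integrable f :=
  Integrable.of_bound hf.measurable.aestronglyMeasurable 1 (ae_of_all _ hf.abs_le)

theorem mul (hf : IsUnitBounded f) (hg : IsUnitBounded g) : IsUnitBounded (fun x => f x * g x) :=
  ⟨hf.measurable.mul hg.measurable, fun x => by
    rw [abs_mul]; exact mul_le_one₀ (hf.abs_le x) (abs_nonneg _) (hg.abs_le x)⟩

theorem comp_add (hf : IsUnitBounded f) (t : UnitAddCircle) : IsUnitBounded (fun x => f (x + t)) :=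
  ⟨hf.measurable.comp (measurable_add_const t), fun _ => hf.abs_le _⟩

theorem comp_sub (hf : IsUnitBounded f) (t : UnitAddCircle) :
    IsUnitBounded (fun x => f (x - t)) := by
  simpa only [sub_eq_add_neg] using hf.comp_add (-t)

theorem prod {ι : Type*} {F : ι → UnitAddCircle → ℝ} (s : Finset ι)
    (hF : ∀ i ∈ s, IsUnitBounded (F i)) : IsUnitBounded (fun x => ∏ i ∈ s, F i x) := by
  classical
  induction s using Finset.induction_on with
  | empty => exact ⟨by simp, fun _ => by simp⟩
  | insert i s hi ih =>
    simp only [Finset.prod_insert hi]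
    exact (hF i (by simp)).mul (ih fun j hj => hF j (by simp [hj]))

theorem abs_integral_le (hf : IsUnitBounded f) : |∫ x, f x| ≤ 1 := by
  have := norm_integral_le_of_norm_le_const (μ := (volume : Measure UnitAddCircle)) (f := f)
    (ae_of_all _ hf.abs_le)
  simpa using this

theorem integrable_abs_sub (hf : IsUnitBounded f) (hg : IsUnitBounded g) :
    Integrable (fun x => |f x - g x|) :=
  (hf.integrable.sub hg.integrable).abs

end IsUnitBounded

section transDist

variable {f g : UnitAddCircle → ℝ}

theorem transDist_nonneg (f : UnitAddCircle → ℝ) (t : UnitAddCircle) : 0 ≤ transDist f t :=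
  integral_nonneg fun _ => abs_nonneg _

theorem transDist_zero (f : UnitAddCircle → ℝ) : transDist f 0 = 0 := by
  simp [transDist]

theorem transDist_neg (f : UnitAddCircle → ℝ) (t : UnitAddCircle) :
    transDist f (-t) = transDist f t := by
  rw [transDist, ← integral_add_right_eq_self _ t]
  simp only [add_neg_cancel_right]
  exact integral_congr_ae (ae_of_all _ fun x => abs_sub_comm _ _)

theorem transDist_comp_add (f : UnitAddCircle → ℝ) (c t : UnitAddCircle) :
    transDist (fun x => f (x + c)) t = transDist f t := by
  rw [transDist, transDist, ← integral_add_right_eq_self (fun x => |f (x + t) - f x|) c]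
  simp only [add_right_comm]

theorem transDist_comp_sub (f : UnitAddCircle → ℝ) (c t : UnitAddCircle) :
    transDist (fun x => f (x - c)) t = transDist f t := by
  simpa only [sub_eq_add_neg] using transDist_comp_add f (-c) t

theorem transDist_add_le (hf : IsUnitBounded f) (s t : UnitAddCircle) :
    transDist f (s + t) ≤ transDist f s + transDist f t := by
  have h1 : transDist f s = ∫ x, |f (x + t + s) - f (x + t)| :=
    (integral_add_right_eq_self (fun x => |f (x + s) - f x|) t).symm
  rw [h1, transDist, transDist, ← integral_add]
  · refine integral_mono ((hf.comp_add _).integrable_abs_sub hf)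
      (Integrable.add ?_ ((hf.comp_add _).integrable_abs_sub hf)) fun x => ?_
    · exact ((hf.comp_add s).comp_add t).integrable_abs_sub (hf.comp_add t)
    · rw [← add_assoc, add_right_comm]
      exact abs_sub_le _ _ _
  · exact ((hf.comp_add s).comp_add t).integrable_abs_sub (hf.comp_add t)
  · exact (hf.comp_add _).integrable_abs_sub hf

theorem transDist_nsmul_le (hf : IsUnitBounded f) (t : UnitAddCircle) (j : ℕ) :
    transDist f (j • t) ≤ j * transDist f t := by
  induction j with
  | zero => simp [transDist_zero]
  | succ j ih =>
    rw [succ_nsmul]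
    refine (transDist_add_le hf _ _).trans ?_
    push_cast
    linarith

theorem abs_mul_sub_mul_le {a b c d : ℝ} (ha : |a| ≤ 1) (hd : |d| ≤ 1) :
    |a * b - c * d| ≤ |b - d| + |a - c| := by
  calc |a * b - c * d| = |a * (b - d) + (a - c) * d| := by ring_nf
    _ ≤ |a * (b - d)| + |(a - c) * d| := abs_add_le _ _
    _ = |a| * |b - d| + |a - c| * |d| := by rw [abs_mul, abs_mul]
    _ ≤ 1 * |b - d| + |a - c| * 1 := by gcongr
    _ = _ := by ring

theorem transDist_mul_le (hf : IsUnitBounded f) (hg : IsUnitBounded g) (t : UnitAddCircle) :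
    transDist (fun x => f x * g x) t ≤ transDist f t + transDist g t := by
  rw [add_comm, transDist, transDist, transDist, ← integral_add]
  · refine integral_mono (((hf.mul hg).comp_add t).integrable_abs_sub (hf.mul hg)) ?_ fun x => ?_
    · exact ((hg.comp_add _).integrable_abs_sub hg).add ((hf.comp_add _).integrable_abs_sub hf)
    · exact abs_mul_sub_mul_le (hf.abs_le _) (hg.abs_le _)
  · exact (hg.comp_add _).integrable_abs_sub hg
  · exact (hf.comp_add _).integrable_abs_sub hf

theorem transDist_prod_le {ι : Type*} {F : ι → UnitAddCircle → ℝ} (s : Finset ι)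
    (hF : ∀ i ∈ s, IsUnitBounded (F i)) (t : UnitAddCircle) :
    transDist (fun x => ∏ i ∈ s, F i x) t ≤ ∑ i ∈ s, transDist (F i) t := by
  classical
  induction s using Finset.induction_on with
  | empty => simp [transDist]
  | insert i s hi ih =>
    simp only [Finset.prod_insert hi, Finset.sum_insert hi]
    have hs : ∀ j ∈ s, IsUnitBounded (F j) := fun j hj => hF j (by simp [hj])
    exact (transDist_mul_le (hF i (by simp)) (.prod s hs) t).trans (by gcongr; exact ih hs)

/-- Translation acts continuously on `L¹`. -/
theorem tendsto_transDist (hf : IsUnitBounded f) :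
    Tendsto (transDist f) (nhds 0) (nhds 0) := by
  have hm : MemLp f 1 (volume : Measure UnitAddCircle) := memLp_one_iff_integrable.2 hf.integrable
  have hmp : ∀ t : UnitAddCircle, MeasurePreserving (fun x : UnitAddCircle => x + t) volume volume :=
    fun t => measurePreserving_add_right volume t
  let G : C(UnitAddCircle, C(UnitAddCircle, UnitAddCircle)) :=
    (ContinuousMap.mk (fun a : UnitAddCircle × UnitAddCircle => a.2 + a.1)
      (by fun_prop)).curry
  have hc : Continuous fun t : UnitAddCircle =>
      Lp.compMeasurePreserving (G t) (hmp t) (hm.toLp f) :=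
    Continuous.compMeasurePreservingLp continuous_const G.continuous hmp (by simp)
  have h2 : ∀ t, transDist f t =
      ‖Lp.compMeasurePreserving (G t) (hmp t) (hm.toLp f) - hm.toLp f‖ := by
    intro t
    rw [L1.norm_eq_integral_norm, transDist]
    refine integral_congr_ae ?_
    have e1 := Lp.coeFn_compMeasurePreserving (hm.toLp f) (hmp t)
    have e2 := (hmp t).quasiMeasurePreserving.ae_eq_comp hm.coeFn_toLp
    filter_upwards [e1, e2, hm.coeFn_toLp, Lp.coeFn_sub
      (Lp.compMeasurePreserving (G t) (hmp t) (hm.toLp f)) (hm.toLp f)] with x h1 h2 h3 h4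
    rw [h4, Pi.sub_apply, h3, Real.norm_eq_abs]
    have : (Lp.compMeasurePreserving (G t) (hmp t) (hm.toLp f)) x = f (x + t) := by
      exact h1.trans h2
    rw [this]
  have h3 : Continuous (transDist f) := by
    rw [funext h2]
    exact (hc.sub continuous_const).norm
  simpa [transDist_zero] using h3.tendsto 0

/-- If `g` is, against `f`, almost the same as all its translates, then `f` and `g` are almost
uncorrelated. -/
theorem abs_covariance_le (hf : IsUnitBounded f) (hg : IsUnitBounded g) {ε : ℝ}
    (h : ∀ s, |∫ x, f x * (g (x + s) - g x)| ≤ ε) :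
    |(∫ x, f x * g x) - (∫ x, f x) * ∫ x, g x| ≤ ε := by
  have hint : Integrable (fun z : UnitAddCircle × UnitAddCircle => f z.2 * g (z.2 + z.1))
      (volume.prod volume) := by
    refine Integrable.of_bound (C := 1) ?_ (ae_of_all _ fun z => ?_)
    · exact ((hf.measurable.comp measurable_snd).mul
        (hg.measurable.comp (measurable_snd.add measurable_fst))).aestronglyMeasurable
    · rw [Real.norm_eq_abs, abs_mul]
      exact mul_le_one₀ (hf.abs_le _) (abs_nonneg _) (hg.abs_le _)
  have h1 : (∫ s, ∫ x, f x * g (x + s)) = (∫ x, f x) * ∫ x, g x := by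
    rw [integral_integral_swap hint, ← integral_mul_const]
    refine integral_congr_ae (ae_of_all _ fun x => ?_)
    simp only [integral_const_mul]
    rw [integral_add_left_eq_self g x]
  have h2 : ∀ s, (∫ x, f x * (g (x + s) - g x)) =
      (∫ x, f x * g (x + s)) - ∫ x, f x * g x := by
    intro s
    rw [← integral_sub (hf.mul (hg.comp_add s)).integrable (hf.mul hg).integrable]
    simp only [mul_sub]
  have h3 : (∫ s, ∫ x, f x * (g (x + s) - g x)) =
      (∫ x, f x) * (∫ x, g x) - ∫ x, f x * g x := by
    simp only [h2]
    rw [integral_sub hint.integral_prod_left (integrable_const _), h1]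
    simp
  rw [abs_sub_comm, ← h3]
  have := norm_integral_le_of_norm_le_const (μ := (volume : Measure UnitAddCircle))
    (f := fun s => ∫ x, f x * (g (x + s) - g x)) (ae_of_all _ h)
  simpa using this

theorem abs_integral_mul_translate_sub_le (hf : IsUnitBounded f) (hg : IsUnitBounded g)
    (s : UnitAddCircle) : |∫ x, f x * (g (x + s) - g x)| ≤ transDist g s := by
  refine (abs_integral_le_integral_abs).trans
    (integral_mono ?_ ((hg.comp_add s).integrable_abs_sub hg) fun x => ?_)
  · have := ((hf.mul (hg.comp_add s)).integrable.sub (hf.mul hg).integrable).abs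
    simpa only [mul_sub, Pi.sub_apply] using this
  · simp only [abs_mul]
    exact mul_le_of_le_one_left (abs_nonneg _) (hf.abs_le x)

/-- Part of a translation can be moved from one factor of an integral to the other. -/
theorem abs_integral_mul_translate_add_sub_le (hf : IsUnitBounded f) (hg : IsUnitBounded g)
    (s t : UnitAddCircle) :
    |∫ x, f x * (g (x + (s + t)) - g x)| ≤ transDist g s + transDist f t := by
  have hg' := hg.comp_add s
  have e : (∫ x, f x * (g (x + (s + t)) - g x)) =
      (∫ x, f x * (g (x + s) - g x)) - ∫ x, g (x + s) * (f (x + -t) - f x) * -1 := by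
    have e1 : (∫ x, f x * g (x + (s + t))) = ∫ x, g (x + s) * f (x + -t) := by
      rw [← integral_add_right_eq_self (fun x => g (x + s) * f (x + -t)) t]
      refine integral_congr_ae (ae_of_all _ fun x => ?_)
      have e2 : x + t + s = x + (s + t) := by abel
      simp only [add_neg_cancel_right, e2, mul_comm]
    have i1 := (hf.mul (hg.comp_add (s + t))).integrable
    have i2 := (hf.mul hg).integrable
    have i3 := (hf.mul (hg.comp_add s)).integrable
    have i4 := ((hg.comp_add s).mul (hf.comp_add (-t))).integrable
    have i5 := ((hg.comp_add s).mul hf).integrable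
    simp only [mul_sub, integral_mul_const]
    rw [integral_sub i1 i2, integral_sub i3 i2, integral_sub i4 i5, e1]
    simp only [mul_comm (f _)]
    ring
  rw [e, integral_mul_const, mul_neg_one, sub_neg_eq_add]
  refine (abs_add_le _ _).trans (add_le_add (abs_integral_mul_translate_sub_le hf hg s) ?_)
  rw [← transDist_neg f t]
  exact abs_integral_mul_translate_sub_le hg' hf (-t)

end transDist

/-! ### Sign functions of arcs -/

open Classical in
/-- The function on the circle that is `-1` on the arc `[0, r)` and `1` elsewhere. -/
noncomputable def arcSign (r : ℝ) (x : UnitAddCircle) : ℝ :=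
  if x ∈ (fun t : ℝ => (t : UnitAddCircle)) '' Set.Ico 0 r then -1 else 1

theorem mem_arc_iff {r : ℝ} (hr : r ≤ 1) {y : ℝ} (hy : y ∈ Set.Ico (0 : ℝ) 1) :
    (y : UnitAddCircle) ∈ (fun t : ℝ => (t : UnitAddCircle)) '' Set.Ico 0 r ↔ y < r := by
  constructor
  · rintro ⟨t, ht, hty⟩
    have : t = y := (AddCircle.coe_eq_coe_iff_of_mem_Ico (p := (1 : ℝ)) (a := 0)
      ⟨ht.1, by simpa using ht.2.trans_le hr⟩ (by simpa using hy)).1 hty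
    exact this ▸ ht.2
  · exact fun h => ⟨y, ⟨hy.1, h⟩, rfl⟩

theorem exists_coe_eq_Ico (x : UnitAddCircle) : ∃ y ∈ Set.Ico (0 : ℝ) 1, (y : UnitAddCircle) = x := by
  have := AddCircle.coe_image_Ico_eq (p := (1 : ℝ)) 0
  have hx : x ∈ ((↑) : ℝ → UnitAddCircle) '' Set.Ico 0 (0 + 1) := by rw [this]; trivial
  simpa using hx

theorem coe_intCast_eq_zero (k : ℤ) : ((k : ℝ) : UnitAddCircle) = 0 :=
  (AddCircle.coe_eq_zero_iff (p := (1 : ℝ))).2 ⟨k, by simp⟩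

theorem exists_coe_eq_abs_eq_norm (x : UnitAddCircle) :
    ∃ y : ℝ, |y| = ‖x‖ ∧ (y : UnitAddCircle) = x := by
  induction x using QuotientAddGroup.induction_on with
  | H y =>
    refine ⟨y - round y, (UnitAddCircle.norm_eq).symm, ?_⟩
    rw [AddCircle.coe_sub, coe_intCast_eq_zero, sub_zero]

theorem arcSign_coe {r : ℝ} (hr : r ≤ 1) {y : ℝ} (hy : y ∈ Set.Ico (0 : ℝ) 1) :
    arcSign r y = if y < r then -1 else 1 := by
  simp only [arcSign, mem_arc_iff hr hy]

theorem arcSign_eq_or (r : ℝ) (x : UnitAddCircle) : arcSign r x = 1 ∨ arcSign r x = -1 := by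
  unfold arcSign; split_ifs <;> simp

theorem arcSign_mul_self (r : ℝ) (x : UnitAddCircle) : arcSign r x * arcSign r x = 1 := by
  rcases arcSign_eq_or r x with h | h <;> simp [h]

theorem measurableSet_arc (r : ℝ) :
    MeasurableSet ((fun t : ℝ => (t : UnitAddCircle)) '' Set.Ico 0 r) := by
  rcases le_or_gt r 1 with hr | hr
  · have : (fun t : ℝ => (t : UnitAddCircle)) '' Set.Ico 0 r =
        (fun x => ((AddCircle.measurableEquivIco 1 0 x : ℝ))) ⁻¹' Set.Iio r := by
      ext x
      obtain ⟨y, hy, rfl⟩ := exists_coe_eq_Ico x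
      have hy' : y ∈ Set.Ico (0 : ℝ) (0 + 1) := by simpa using hy
      have e : ((AddCircle.measurableEquivIco 1 0 (y : UnitAddCircle)) : ℝ) = y :=
        congrArg Subtype.val (AddCircle.equivIco_coe_eq (p := (1 : ℝ)) hy')
      rw [mem_arc_iff hr hy, Set.mem_preimage, e, Set.mem_Iio]
    rw [this]
    exact measurableSet_Iio.preimage
      (measurable_subtype_coe.comp (AddCircle.measurableEquivIco 1 0).measurable)
  · convert MeasurableSet.univ
    refine Set.eq_univ_of_forall fun x => ?_
    obtain ⟨y, hy, rfl⟩ := exists_coe_eq_Ico x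
    exact ⟨y, ⟨hy.1, hy.2.trans hr⟩, rfl⟩

theorem isUnitBounded_arcSign (r : ℝ) : IsUnitBounded (arcSign r) :=
  ⟨by
    classical
    exact Measurable.ite (measurableSet_arc r) measurable_const measurable_const,
  fun x => by rcases arcSign_eq_or r x with h | h <;> simp [h]⟩

/-- Adjacent arcs concatenate. -/
theorem arcSign_mul_arcSign_sub {r s : ℝ} (hr : 0 ≤ r) (hs : 0 ≤ s) (hrs : r + s ≤ 1)
    (x : UnitAddCircle) : arcSign r x * arcSign s (x - (r : UnitAddCircle)) = arcSign (r + s) x := by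
  obtain ⟨y, hy, rfl⟩ := exists_coe_eq_Ico x
  have hy' := hy
  obtain ⟨h0, h1⟩ := hy'
  rw [arcSign_coe (by linarith) hy, arcSign_coe hrs hy]
  rcases lt_or_ge y r with hyr | hyr
  · have e : (y : UnitAddCircle) - (r : UnitAddCircle) = ((y - r + 1 : ℝ) : UnitAddCircle) := by
      rw [AddCircle.coe_add, AddCircle.coe_period, add_zero, AddCircle.coe_sub]
    rw [e, arcSign_coe (by linarith) ⟨by linarith, by linarith⟩, if_pos hyr,
      if_neg (by linarith), if_pos (by linarith)]
    simp
  · rw [← AddCircle.coe_sub, arcSign_coe (by linarith) ⟨by linarith, by linarith⟩,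
      if_neg (by linarith), one_mul]
    congr 1
    rw [sub_lt_iff_lt_add']

theorem integral_arcSign {r : ℝ} (hr : 0 ≤ r) (hr1 : r ≤ 1) : ∫ x, arcSign r x = 1 - 2 * r := by
  have h := AddCircle.intervalIntegral_preimage 1 0 (arcSign r)
  rw [← h, zero_add]
  have e1 : ∫ y in (0 : ℝ)..r, arcSign r y = ∫ y in (0 : ℝ)..r, (-1 : ℝ) := by
    rw [intervalIntegral.integral_of_le hr, intervalIntegral.integral_of_le hr,
      ← integral_Ico_eq_integral_Ioc, ← integral_Ico_eq_integral_Ioc]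
    refine setIntegral_congr_fun measurableSet_Ico fun y hy => ?_
    rw [arcSign_coe hr1 ⟨hy.1, hy.2.trans_le hr1⟩, if_pos hy.2]
  have e2 : ∫ y in r..1, arcSign r y = ∫ y in r..1, (1 : ℝ) := by
    rw [intervalIntegral.integral_of_le hr1, intervalIntegral.integral_of_le hr1,
      ← integral_Ico_eq_integral_Ioc, ← integral_Ico_eq_integral_Ioc]
    refine setIntegral_congr_fun measurableSet_Ico fun y hy => ?_
    rw [arcSign_coe hr1 ⟨hr.trans hy.1, hy.2⟩, if_neg (not_lt.2 hy.1)]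
  have hm : Measurable fun y : ℝ => arcSign r y :=
    (isUnitBounded_arcSign r).measurable.comp AddCircle.measurable_mk'
  have hi : ∀ a b : ℝ, IntervalIntegrable (fun y : ℝ => arcSign r y) volume a b := fun a b =>
    (intervalIntegrable_const (c := (1 : ℝ))).mono_fun hm.aestronglyMeasurable
      (ae_of_all _ fun y => by simpa using (isUnitBounded_arcSign r).abs_le y)
  rw [← intervalIntegral.integral_add_adjacent_intervals (hi 0 r) (hi r 1), e1, e2]
  simp
  ring

theorem integral_abs_one_sub_arcSign {r : ℝ} (hr : 0 ≤ r) (hr1 : r ≤ 1) :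
    ∫ x, |1 - arcSign r x| = 2 * r := by
  have : ∀ x, |1 - arcSign r x| = 1 - arcSign r x := fun x =>
    abs_of_nonneg (by rcases arcSign_eq_or r x with h | h <;> norm_num [h])
  simp only [this]
  rw [integral_sub (integrable_const _) (isUnitBounded_arcSign r).integrable,
    integral_arcSign hr hr1]
  simp

theorem isUnitBounded_one : IsUnitBounded fun _ => 1 := ⟨measurable_const, fun _ => by simp⟩

/-- Lengthening an arc by `s` changes its sign function by `2 s` in `L¹`. -/
theorem integral_abs_arcSign_sub_le {r s : ℝ} (hr : 0 ≤ r) (hs : 0 ≤ s) (hrs : r + s ≤ 1) :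
    ∫ x, |arcSign (r + s) x - arcSign r x| ≤ 2 * s := by
  have : ∀ x, |arcSign (r + s) x - arcSign r x| =
      |1 - arcSign s (x - (r : UnitAddCircle))| := by
    intro x
    rw [← arcSign_mul_arcSign_sub hr hs hrs, abs_sub_comm]
    rcases arcSign_eq_or r x with h | h <;> rw [h]
    · simp
    · rw [← abs_neg]; ring_nf
  simp only [this, sub_eq_add_neg (_ : UnitAddCircle)]
  rw [integral_add_right_eq_self (fun x => |1 - arcSign s x|),
    integral_abs_one_sub_arcSign hs (by linarith)]

/-- Translating an arc by `t` changes membership only near its two end points. -/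
theorem transDist_arcSign_le {r : ℝ} (hr : 0 ≤ r) (hr1 : r ≤ 1 / 2) (t : UnitAddCircle) :
    transDist (arcSign r) t ≤ 4 * ‖t‖ := by
  have key : ∀ τ : ℝ, 0 ≤ τ → τ ≤ 1 / 2 → transDist (arcSign r) (-(τ : UnitAddCircle)) ≤ 4 * τ := by
    intro τ h0 h1
    have hU := isUnitBounded_arcSign τ
    -- Both orders of concatenating an arc of length `τ` and one of length `r` give the same arc, so
    -- the translated sign function differs from the original by the signs of two arcs of length `τ`.
    have e : ∀ x, |arcSign r (x + -(τ : UnitAddCircle)) - arcSign r x| ≤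
        |1 - arcSign τ x| + |1 - arcSign τ (x - (r : UnitAddCircle))| := by
      intro x
      have h2 := arcSign_mul_arcSign_sub h0 hr (by linarith) x
      rw [add_comm, ← arcSign_mul_arcSign_sub hr h0 (by linarith) x, sub_eq_add_neg x (τ : _)] at h2
      have h3 := arcSign_eq_or τ x
      have h4 := arcSign_eq_or r x
      have h5 := arcSign_eq_or τ (x - (r : UnitAddCircle))
      have h6 := arcSign_eq_or r (x + -(τ : UnitAddCircle))
      generalize arcSign τ (x - (r : UnitAddCircle)) = u at *
      generalize arcSign r (x + -(τ : UnitAddCircle)) = v at *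
      rcases h3 with h3 | h3 <;> rcases h4 with h4 | h4 <;> rcases h5 with h5 | h5 <;>
        rcases h6 with h6 | h6 <;> rw [h3, h4, h5, h6] at h2 <;> simp only [h3, h4, h5, h6] <;>
        first | (exfalso; norm_num at h2; done) | norm_num
    have i1 : Integrable fun x => |1 - arcSign τ x| := isUnitBounded_one.integrable_abs_sub hU
    have i2 : Integrable fun x => |1 - arcSign τ (x - (r : UnitAddCircle))| :=
      isUnitBounded_one.integrable_abs_sub (hU.comp_sub _)
    have hr' := isUnitBounded_arcSign r
    refine (integral_mono ((hr'.comp_add _).integrable_abs_sub hr') (i1.add i2) e).trans ?_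
    simp only [Pi.add_apply]
    rw [integral_add i1 i2, integral_sub_right_eq_self (fun x => |1 - arcSign τ x|),
      integral_abs_one_sub_arcSign h0 (by linarith)]
    linarith
  obtain ⟨y, hy, rfl⟩ := exists_coe_eq_abs_eq_norm t
  have hn := AddCircle.norm_le_half_period (1 : ℝ) one_ne_zero (x := (y : UnitAddCircle))
  rw [← hy] at hn ⊢
  simp only [abs_one, abs_le] at hn
  rcases le_or_gt 0 y with h | h
  · rw [← transDist_neg, abs_of_nonneg h]
    exact key y h (by linarith)
  · have := key (-y) (by linarith) (by linarith)
    rwa [AddCircle.coe_neg, neg_neg, ← abs_of_neg h] at this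

theorem norm_sub_lt_of_mem_arc {r : ℝ} {x y : UnitAddCircle} (hx : arcSign r x = -1)
    (hy : arcSign r y = -1) : ‖x - y‖ < r := by
  have h : ∀ {z}, arcSign r z = -1 → ∃ t ∈ Set.Ico 0 r, (t : UnitAddCircle) = z := by
    intro z hz
    unfold arcSign at hz
    split_ifs at hz with hm
    · exact hm
    · norm_num at hz
  obtain ⟨s, hs, rfl⟩ := h hx
  obtain ⟨t, ht, rfl⟩ := h hy
  rw [← AddCircle.coe_sub]
  rw [UnitAddCircle.norm_eq]
  refine (round_le (s - t) 0).trans_lt ?_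
  rw [Int.cast_zero, sub_zero, abs_lt]
  exact ⟨by linarith [hs.1, ht.2], by linarith [hs.2, ht.1]⟩

/-- The product of the sign functions of the arcs `[j a, j a + r)`, `j < m`. -/
noncomputable def arcProd (a : UnitAddCircle) (r : ℝ) (m : ℕ) (x : UnitAddCircle) : ℝ :=
  ∏ j ∈ Finset.range m, arcSign r (x - j • a)

theorem isUnitBounded_arcProd (a : UnitAddCircle) (r : ℝ) (m : ℕ) :
    IsUnitBounded (arcProd a r m) :=
  .prod _ fun _ _ => (isUnitBounded_arcSign r).comp_sub _

theorem arcProd_mul_self (a : UnitAddCircle) (r : ℝ) (m : ℕ) (x : UnitAddCircle) :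
    arcProd a r m x * arcProd a r m x = 1 := by
  rw [arcProd, ← Finset.prod_mul_distrib]
  exact Finset.prod_eq_one fun j _ => arcSign_mul_self _ _

theorem arcProd_add (a : UnitAddCircle) (r : ℝ) (m k : ℕ) (x : UnitAddCircle) :
    arcProd a r (m + k) x = arcProd a r m x * arcProd a r k (x - m • a) := by
  rw [arcProd, Finset.prod_range_add]
  simp only [arcProd, add_smul, sub_sub]

theorem transDist_arcProd_le {a : UnitAddCircle} {r : ℝ} (hr : 0 ≤ r) (hr1 : r ≤ 1 / 2) (m : ℕ)
    (t : UnitAddCircle) : transDist (arcProd a r m) t ≤ 4 * m * ‖t‖ := by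
  refine (transDist_prod_le _ (fun _ _ => (isUnitBounded_arcSign r).comp_sub _) t).trans ?_
  calc ∑ j ∈ Finset.range m, transDist (fun x => arcSign r (x - j • a)) t
      ≤ ∑ _j ∈ Finset.range m, 4 * ‖t‖ := Finset.sum_le_sum fun j _ => by
        rw [transDist_comp_sub]; exact transDist_arcSign_le hr hr1 t
    _ = 4 * m * ‖t‖ := by simp; ring

/-- When the arcs are disjoint, the product of signs is read off from their total length. -/
theorem integral_arcProd {a : UnitAddCircle} {r : ℝ} (hr : 0 ≤ r) (hr1 : r ≤ 1) (m : ℕ)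
    (h : ∀ j, 0 < j → j < m → r ≤ ‖j • a‖) : ∫ x, arcProd a r m x = 1 - 2 * m * r := by
  -- At most one factor is `-1`, so the product is an affine function of the factors.
  have hpt : ∀ k ≤ m, ∀ x, arcProd a r k x = 1 - ∑ j ∈ Finset.range k, (1 - arcSign r (x - j • a)) := by
    intro k
    induction k with
    | zero => simp [arcProd]
    | succ k ih =>
      intro hk x
      rw [Finset.sum_range_succ, arcProd, Finset.prod_range_succ, ← arcProd]
      rcases arcSign_eq_or r (x - k • a) with h1 | h1
      · rw [h1, ih (by lia)]; ring
      · have h2 : ∀ j ∈ Finset.range k, arcSign r (x - j • a) = 1 := by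
          intro j hj
          rw [Finset.mem_range] at hj
          refine (arcSign_eq_or r _).resolve_right fun h3 => ?_
          have h4 := norm_sub_lt_of_mem_arc h3 h1
          have h5 : x - j • a - (x - k • a) = (k - j) • a := by
            rw [sub_nsmul _ hj.le]; abel
          rw [h5] at h4
          exact absurd h4 (not_lt.2 (h _ (by lia) (by lia)))
        rw [arcProd, Finset.prod_eq_one h2, Finset.sum_eq_zero fun j hj => by rw [h2 j hj, sub_self],
          h1]
        norm_num
  have hi : ∀ j : ℕ, Integrable fun x => 1 - arcSign r (x - j • a) := fun j =>
    (integrable_const 1).sub ((isUnitBounded_arcSign r).comp_sub _).integrable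
  simp only [hpt m le_rfl]
  rw [integral_sub (integrable_const _) (integrable_finsetSum _ fun j _ => hi j),
    integral_finsetSum _ fun j _ => hi j]
  have : ∀ j : ℕ, ∫ x, (1 - arcSign r (x - j • a)) = 2 * r := by
    intro j
    rw [integral_sub (integrable_const _) ((isUnitBounded_arcSign r).comp_sub _).integrable,
      integral_sub_right_eq_self, integral_arcSign hr hr1]
    simp
  simp [this]
  ring

/-! ### Orbits of the rotation -/

namespace ContFractData

variable {α : ℝ} {a q : ℕ → ℕ} {p : ℕ → ℤ}

theorem one_le_den (h : ContFractData α a q p) (i : ℕ) : (1 : ℝ) ≤ q i := by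
  exact_mod_cast h.den_pos i

theorem abs_mul_error_le (h : ContFractData α a q p) (i : ℕ) {j : ℕ} (hj : j < q i) :
    |j * ((q i : ℝ) * α - p i) / q i| ≤ 1 / q (i + 1) := by
  have h1 := h.one_le_den i
  have hj' : (j : ℝ) / q i ≤ 1 := by
    rw [div_le_one (by linarith)]; exact_mod_cast hj.le
  calc |j * ((q i : ℝ) * α - p i) / q i| = (j / q i : ℝ) * |(q i : ℝ) * α - p i| := by
        rw [mul_div_right_comm, abs_mul, abs_of_nonneg (by positivity)]
    _ ≤ 1 * (1 / q (i + 1)) := by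
        gcongr
        exact h.abs_sub_le i
    _ = _ := one_mul _

/-- The first `q_i` points of an orbit are `2 / q_i`-dense in the circle. -/
theorem exists_eq_nsmul_add (h : ContFractData α a q p) (i : ℕ) (s : UnitAddCircle) :
    ∃ j < q i, ∃ t : UnitAddCircle, s = j • (α : UnitAddCircle) + t ∧ ‖t‖ ≤ 2 / q i := by
  induction s using QuotientAddGroup.induction_on with
  | H y =>
    have hq := h.one_le_den i
    have hq0 : (0 : ℝ) < q i := by linarith
    obtain ⟨u, v, huv⟩ := h.isCoprime i
    set r : ℤ := ⌊y * q i⌋ with hr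
    have hqz : (0 : ℤ) < q i := by exact_mod_cast h.den_pos i
    obtain ⟨j, hj⟩ := Int.eq_ofNat_of_zero_le (Int.emod_nonneg (r * u) hqz.ne')
    have hjlt : j < q i := by
      have := Int.emod_lt_of_pos (r * u) hqz
      rw [hj] at this
      exact_mod_cast this
    have hk : ∃ k : ℤ, (j : ℤ) * p i = r + q i * k := by
      refine ⟨-(r * v) - r * u / q i * p i, ?_⟩
      have h1 := Int.emod_add_mul_ediv (r * u) (q i)
      rw [hj] at h1
      linear_combination p i * h1 + r * huv
    obtain ⟨k, hk⟩ := hk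
    have hk' : (j : ℝ) * p i = r + q i * k := by exact_mod_cast hk
    have herr := h.abs_mul_error_le i hjlt
    set e : ℝ := j * ((q i : ℝ) * α - p i) / q i with he
    have hjα : j * α = r / q i + k + e := by
      rw [he]; field_simp; linear_combination hk'
    have h1 : (1 : ℝ) / q (i + 1) ≤ 1 / q i := by
      gcongr
      exact_mod_cast h.den_mono (Nat.le_succ i)
    have hfl := Int.floor_le (y * q i)
    have hfl' := Int.lt_floor_add_one (y * q i)
    rw [← hr] at hfl hfl'
    have hy0 : (r : ℝ) / q i ≤ y := by rwa [div_le_iff₀ hq0]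
    have hy1 : y ≤ r / q i + 1 / q i := by
      rw [← add_div, le_div_iff₀ hq0]; exact hfl'.le
    refine ⟨j, hjlt, ((y - r / q i - e : ℝ) : UnitAddCircle), ?_, ?_⟩
    · have : y = j * α + (y - r / q i - e) - k := by rw [hjα]; ring
      conv_lhs => rw [this]
      rw [← nsmul_eq_mul]
      change ((j • α + (y - r / q i - e) - k : ℝ) : UnitAddCircle) = _
      rw [AddCircle.coe_sub, coe_intCast_eq_zero, sub_zero, AddCircle.coe_add, AddCircle.coe_nsmul]
    · rw [UnitAddCircle.norm_eq]
      refine (round_le _ 0).trans ?_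
      rw [Int.cast_zero, sub_zero, abs_le]
      have h2 : (2 : ℝ) / q i = 1 / q i + 1 / q i := by ring
      have := abs_le.1 herr
      constructor <;> linarith

/-- The first `q_i` points of an orbit are separated. -/
theorem le_norm_nsmul (h : ContFractData α a q p) (i : ℕ) {j : ℕ} (hj0 : 0 < j) (hj : j < q i) :
    1 / (q i : ℝ) - 1 / q (i + 1) ≤ ‖j • (α : UnitAddCircle)‖ := by
  have hq0 : (0 : ℝ) < q i := by linarith [h.one_le_den i]
  rw [← AddCircle.coe_nsmul, UnitAddCircle.norm_eq, nsmul_eq_mul]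
  set r := round (j * α)
  have hne : (j : ℤ) * p i - q i * r ≠ 0 := by
    intro h0
    have hd : (q i : ℤ) ∣ j * p i := ⟨r, by linarith⟩
    have hd' := (h.isCoprime i).symm.dvd_of_dvd_mul_right hd
    have := Nat.le_of_dvd hj0 (Int.natCast_dvd_natCast.1 hd')
    lia
  have h1 : (1 : ℝ) ≤ |(j : ℝ) * p i - q i * r| := by
    exact_mod_cast Int.one_le_abs hne
  have herr := h.abs_mul_error_le i hj
  have e : j * α - r = ((j : ℝ) * p i - q i * r) / q i + j * ((q i : ℝ) * α - p i) / q i := by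
    field_simp; ring
  have h2 : 1 / (q i : ℝ) ≤ |((j : ℝ) * p i - q i * r) / q i| := by
    rw [abs_div, abs_of_pos hq0]; gcongr
  rw [e]
  have := abs_sub_abs_le_abs_add (((j : ℝ) * p i - q i * r) / q i) (j * ((q i : ℝ) * α - p i) / q i)
  linarith

end ContFractData

/-! ### Sign cocycles that are not coboundaries -/

theorem tendsto_zero_of_le_one_sub_mul_add {x b e : ℕ → ℝ} (hx : ∀ k, 0 ≤ x k)
    (hb0 : ∀ k, 0 ≤ b k) (hb1 : ∀ k, b k ≤ 1) (he : ∀ k, 0 ≤ e k)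
    (h : ∀ k, x (k + 1) ≤ (1 - b k) * x k + e k) (hes : Summable e)
    (hb : Tendsto (fun K => ∑ k ∈ Finset.range K, b k) atTop atTop) :
    Tendsto x atTop (nhds 0) := by
  have hind : ∀ K n, x (K + n) ≤ Real.exp (-∑ k ∈ Finset.range n, b (K + k)) * x K +
      ∑ k ∈ Finset.range n, e (K + k) := by
    intro K n
    induction n with
    | zero => simp
    | succ n ih =>
      rw [Finset.sum_range_succ, Finset.sum_range_succ, ← add_assoc, neg_add, Real.exp_add]
      have h0 : 0 ≤ 1 - b (K + n) := by linarith [hb1 (K + n)]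
      have h1 : 1 - b (K + n) ≤ Real.exp (-b (K + n)) := by
        linarith [Real.add_one_le_exp (-b (K + n))]
      have hs : 0 ≤ ∑ k ∈ Finset.range n, e (K + k) := Finset.sum_nonneg fun _ _ => he _
      calc x (K + n + 1) ≤ (1 - b (K + n)) * x (K + n) + e (K + n) := h _
        _ ≤ (1 - b (K + n)) * (Real.exp (-∑ k ∈ Finset.range n, b (K + k)) * x K +
            ∑ k ∈ Finset.range n, e (K + k)) + e (K + n) := by gcongr
        _ ≤ Real.exp (-b (K + n)) * (Real.exp (-∑ k ∈ Finset.range n, b (K + k)) * x K) +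
            1 * (∑ k ∈ Finset.range n, e (K + k)) + e (K + n) := by
          rw [mul_add]
          gcongr
          · exact mul_nonneg (Real.exp_nonneg _) (hx K)
          · linarith [hb0 (K + n)]
        _ = _ := by ring
  rw [Metric.tendsto_atTop]
  intro ε hε
  have htail := tendsto_sum_nat_add e
  obtain ⟨K, hK⟩ := ((tendsto_order.1 htail).2 (ε / 2) (by positivity)).exists
  have hbK : Tendsto (fun n => ∑ k ∈ Finset.range n, b (K + k)) atTop atTop := by
    have h1 := (tendsto_atTop_add_const_right atTop (-∑ k ∈ Finset.range K, b k)
      (hb.comp (tendsto_add_atTop_nat K)))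
    refine h1.congr fun n => ?_
    simp only [Function.comp, add_comm n K]
    rw [Finset.sum_range_add]; ring
  have hexp : Tendsto (fun n => Real.exp (-∑ k ∈ Finset.range n, b (K + k)) * x K) atTop
      (nhds 0) := by
    simpa using (Real.tendsto_exp_neg_atTop_nhds_zero.comp hbK).mul_const (x K)
  obtain ⟨n₀, hn₀⟩ := eventually_atTop.1 ((tendsto_order.1 hexp).2 (ε / 2) (by positivity))
  refine ⟨K + n₀, fun n hn => ?_⟩
  obtain ⟨n', rfl⟩ := Nat.exists_eq_add_of_le (show K ≤ n by lia)
  have h1 := hind K n'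
  have h2 := hn₀ n' (by lia)
  have h3 : ∑ k ∈ Finset.range n', e (K + k) ≤ ∑' k, e (k + K) := by
    simp only [add_comm K]
    exact ((summable_nat_add_iff K).2 hes).sum_le_tsum _ fun _ _ => he _
  rw [Real.dist_eq, sub_zero, abs_of_nonneg (hx _)]
  linarith

namespace ContFractData

variable {α : ℝ} {a q : ℕ → ℕ} {p : ℕ → ℤ}

theorem transDist_le_of_rotation (h : ContFractData α a q p) {f : UnitAddCircle → ℝ}
    (hf : IsUnitBounded f) {η κ : ℝ} (i : ℕ) (hη : transDist f (α : UnitAddCircle) ≤ η)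
    (hκ : ∀ t : UnitAddCircle, ‖t‖ ≤ 2 / q i → transDist f t ≤ κ) (s : UnitAddCircle) :
    transDist f s ≤ q i * η + κ := by
  obtain ⟨j, hj, t, rfl, ht⟩ := h.exists_eq_nsmul_add i s
  have hη0 : 0 ≤ η := (transDist_nonneg _ _).trans hη
  have hj' : (j : ℝ) ≤ q i := by exact_mod_cast hj.le
  calc transDist f (j • (α : UnitAddCircle) + t)
      ≤ transDist f (j • (α : UnitAddCircle)) + transDist f t := transDist_add_le hf _ _
    _ ≤ j * transDist f α + κ := add_le_add (transDist_nsmul_le hf _ _) (hκ t ht)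
    _ ≤ q i * η + κ := by
        gcongr
        exact transDist_nonneg _ _

/-- A function that changes little under the rotation is almost uncorrelated with one that
changes little under short translations. -/
theorem abs_covariance_le_of_rotation (h : ContFractData α a q p) {f g : UnitAddCircle → ℝ}
    (hf : IsUnitBounded f) (hg : IsUnitBounded g) {V d : ℝ} (i : ℕ) (hV0 : 0 ≤ V)
    (hd : transDist g (α : UnitAddCircle) ≤ d)
    (hV : ∀ t : UnitAddCircle, transDist f t ≤ V * ‖t‖) :
    |(∫ x, f x * g x) - (∫ x, f x) * ∫ x, g x| ≤ q i * d + V * (2 / q i) := by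
  refine abs_covariance_le hf hg fun s => ?_
  obtain ⟨j, hj, t, rfl, ht⟩ := h.exists_eq_nsmul_add i s
  have hd0 : 0 ≤ d := (transDist_nonneg _ _).trans hd
  have hj' : (j : ℝ) ≤ q i := by exact_mod_cast hj.le
  calc |∫ x, f x * (g (x + (j • (α : UnitAddCircle) + t)) - g x)|
      ≤ transDist g (j • (α : UnitAddCircle)) + transDist f t :=
        abs_integral_mul_translate_add_sub_le hf hg _ _
    _ ≤ j * transDist g α + V * ‖t‖ := add_le_add (transDist_nsmul_le hg _ _) (hV t)
    _ ≤ q i * d + V * (2 / q i) := by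
        gcongr
        exact transDist_nonneg _ _

/-- Suppose that the sign cocycle `s` is approximated by the coboundaries
`F l x * F l (x - α)`, fast in comparison with `q (m l)`, while the number of sign changes of
`F l` is small in comparison with `q (m l)`. If the `F l` become uncorrelated then `s` is not a
coboundary: a transfer function `u` would be close to `± F l` for all large `l`, because `u * F l`
is almost invariant under `q (m l)` steps of the rotation and under translations by
`2 / q (m l)`, hence almost constant. -/
theorem false_of_sign_cocycle (h : ContFractData α a q p) {F : ℕ → UnitAddCircle → ℝ}
    {s u : UnitAddCircle → ℝ} (hF : ∀ l, IsUnitBounded (F l)) (hF2 : ∀ l x, F l x * F l x = 1)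
    (hs : IsUnitBounded s) (hu : IsUnitBounded u) (hu2 : ∀ᵐ x, u x * u x = 1)
    (hcob : ∀ x, u x = s x * u (x - (α : UnitAddCircle)))
    {m : ℕ → ℕ} {V η : ℕ → ℝ} (hV0 : ∀ l, 0 ≤ V l)
    (hV : ∀ l t, transDist (F l) t ≤ V l * ‖t‖)
    (hη : ∀ l, ∫ x, |s x - F l x * F l (x - (α : UnitAddCircle))| ≤ η l)
    (hm : Tendsto (fun l => (q (m l) : ℝ)) atTop atTop)
    (hVm : Tendsto (fun l => V l / q (m l)) atTop (nhds 0))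
    (hηm : Tendsto (fun l => q (m l) * η l) atTop (nhds 0))
    (hunc : ∀ l, Tendsto (fun L => ∫ x, F l x * F L x) atTop (nhds 0)) : False := by
  have hv : ∀ l, IsUnitBounded (fun x => u x * F l x) := fun l => hu.mul (hF l)
  have hrot : ∀ l, transDist (fun x => u x * F l x) (α : UnitAddCircle) ≤ η l := by
    intro l
    refine le_trans ?_ (hη l)
    rw [← transDist_neg]
    have i2 := hs.integrable_abs_sub ((hF l).mul ((hF l).comp_sub (α : UnitAddCircle)))
    refine integral_mono (((hv l).comp_add _).integrable_abs_sub (hv l)) i2 fun x => ?_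
    have hFx : |F l x| = 1 := by
      have := hF2 l x
      rw [← abs_mul_abs_self] at this
      nlinarith [abs_nonneg (F l x)]
    have e : u (x + -(α : UnitAddCircle)) * F l (x + -(α : UnitAddCircle)) - u x * F l x =
        u (x - α) * (F l x * (F l x * F l (x - α) - s x)) := by
      rw [hcob x, ← sub_eq_add_neg]
      linear_combination (-(u (x - α) * F l (x - α))) * hF2 l x
    simp only
    rw [e, abs_mul, abs_mul, hFx, one_mul, abs_sub_comm]
    exact mul_le_of_le_one_left (abs_nonneg _) (hu.abs_le _)
  have hsmall : ∀ ε > 0, ∀ᶠ l in atTop, ∀ t, transDist (fun x => u x * F l x) t ≤ ε := by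
    intro ε hε
    obtain ⟨δ, hδ, hδ'⟩ := Metric.tendsto_nhds_nhds.1 (tendsto_transDist hu) (ε / 3) (by positivity)
    have h2 : Tendsto (fun l => 2 / (q (m l) : ℝ)) atTop (nhds 0) := hm.const_div_atTop 2
    have h3 := hVm.const_mul 2
    rw [mul_zero] at h3
    filter_upwards [(tendsto_order.1 h2).2 δ hδ, (tendsto_order.1 hηm).2 (ε / 3) (by positivity),
      (tendsto_order.1 h3).2 (ε / 3) (by positivity)] with l h4 h5 h6 t
    refine (h.transDist_le_of_rotation (hv l) (m l) (hrot l) (κ := ε / 3 + ε / 3)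
      (fun t ht => ?_) t).trans (by linarith)
    refine (transDist_mul_le hu (hF l) t).trans (add_le_add ?_ ?_)
    · have := hδ' (x := t) (by rw [dist_zero_right]; linarith)
      rw [dist_zero_right, Real.norm_eq_abs] at this
      exact (le_abs_self _).trans this.le
    · refine (hV l t).trans ((mul_le_mul_of_nonneg_left ht (hV0 l)).trans ?_)
      calc V l * (2 / q (m l)) = 2 * (V l / q (m l)) := by ring
        _ ≤ _ := h6.le
  -- With error `1 / 8` each mean has square at least `7 / 8`, so that correlations stay above
  -- `7 / 8 - 1 / 8 ≥ 1 / 2`.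
  obtain ⟨l₀, hl₀⟩ := eventually_atTop.1 (hsmall (1 / 8) (by norm_num))
  have hcov : ∀ l L, l₀ ≤ L →
      |(∫ x, F l x * F L x) - (∫ x, u x * F l x) * ∫ x, u x * F L x| ≤ 1 / 8 := by
    intro l L hL
    have h1 := abs_covariance_le (hv l) (hv L) (ε := 1 / 8) fun t =>
      (abs_integral_mul_translate_sub_le (hv l) (hv L) t).trans (hl₀ L hL t)
    have e : (∫ x, (u x * F l x) * (u x * F L x)) = ∫ x, F l x * F L x := by
      refine integral_congr_ae ?_
      filter_upwards [hu2] with x hx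
      linear_combination (F l x * F L x) * hx
    rwa [e] at h1
  have hdiag : ∀ l, l₀ ≤ l → 7 / 8 ≤ (∫ x, u x * F l x) ^ 2 := by
    intro l hl
    have h1 := hcov l l hl
    simp only [hF2] at h1
    simp only [integral_const, probReal_univ, smul_eq_mul, mul_one] at h1
    have := (abs_le.1 h1).2
    nlinarith
  have hne : ∀ L, l₀ ≤ L → 1 / 2 ≤ |∫ x, F l₀ x * F L x| := by
    intro L hL
    have h1 := hcov l₀ L hL
    set A := ∫ x, u x * F l₀ x
    set B := ∫ x, u x * F L x
    have h2 : 7 / 8 ≤ |A * B| := by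
      refine abs_le_of_sq_le_sq' ?_ (abs_nonneg _) |>.2
      rw [sq_abs, mul_pow]
      nlinarith [hdiag l₀ le_rfl, hdiag L hL]
    have h3 := abs_sub_abs_le_abs_sub (A * B) (∫ x, F l₀ x * F L x)
    rw [abs_sub_comm] at h3
    linarith
  have hlim := (hunc l₀).abs
  rw [abs_zero] at hlim
  have := ge_of_tendsto hlim (eventually_atTop.2 ⟨l₀, hne⟩)
  norm_num at this

/-- Successive multiplication by functions `z L` of mean at most `1 - b L` in absolute value, that
are almost invariant under the rotation, kills all correlations when `∑ b L` diverges. -/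
theorem tendsto_integral_mul_zero (h : ContFractData α a q p) {F z : ℕ → UnitAddCircle → ℝ}
    (hF : ∀ l, IsUnitBounded (F l)) (hz : ∀ l, IsUnitBounded (z l))
    (hFz : ∀ l x, F (l + 1) x = F l x * z l x)
    {m : ℕ → ℕ} {V d b e : ℕ → ℝ} (hV0 : ∀ l, 0 ≤ V l) (hVm : Monotone V)
    (hV : ∀ l t, transDist (F l) t ≤ V l * ‖t‖)
    (hd : ∀ l, transDist (z l) (α : UnitAddCircle) ≤ d l)
    (hzb : ∀ᶠ l in atTop, |∫ x, z l x| ≤ 1 - b l + e l) (hb0 : ∀ l, 0 ≤ b l)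
    (hb1 : ∀ᶠ l in atTop, b l ≤ 1)
    (he0 : ∀ l, 0 ≤ e l)
    (hb : Tendsto (fun K => ∑ k ∈ Finset.range K, b k) atTop atTop)
    (hsum : Summable fun l => q (m l) * d l + 4 * V l / q (m l) + e l) (l : ℕ) :
    Tendsto (fun L => ∫ x, F l x * F L x) atTop (nhds 0) := by
  rw [tendsto_zero_iff_abs_tendsto_zero]
  obtain ⟨K, hK⟩ := eventually_atTop.1 (hzb.and hb1)
  have hd0 : ∀ l, 0 ≤ d l := fun l => (transDist_nonneg _ _).trans (hd l)
  rw [← tendsto_add_atTop_iff_nat (max K l)]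
  have hbK : Tendsto (fun n => ∑ k ∈ Finset.range n, b (k + max K l)) atTop atTop := by
    have h1 := (tendsto_atTop_add_const_right atTop (-∑ k ∈ Finset.range (max K l), b k)
      (hb.comp (tendsto_add_atTop_nat (max K l))))
    refine h1.congr fun n => ?_
    simp only [Function.comp, add_comm n (max K l)]
    rw [Finset.sum_range_add]
    simp only [add_comm (max K l)]
    ring
  refine tendsto_zero_of_le_one_sub_mul_add (fun _ => abs_nonneg _) (fun k => hb0 (k + max K l))
    (fun k => (hK _ (by lia)).2) (fun k => ?_) (fun k => ?_)
    ((summable_nat_add_iff (max K l)).2 hsum) hbK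
  · have := hd0 (k + max K l)
    have := hV0 (k + max K l)
    have := he0 (k + max K l)
    positivity
  · simp only [Function.comp]
    set L := k + max K l with hL
    have hψ : IsUnitBounded (fun x => F l x * F L x) := (hF l).mul (hF L)
    have hVL : ∀ t : UnitAddCircle, transDist (fun x => F l x * F L x) t ≤ 2 * V L * ‖t‖ := by
      intro t
      refine (transDist_mul_le (hF l) (hF L) t).trans ?_
      have h1 := hV l t
      have h2 := hV L t
      have h3 : V l * ‖t‖ ≤ V L * ‖t‖ := by
        gcongr
        exact hVm (by lia)
      linarith
    have hc := h.abs_covariance_le_of_rotation hψ (hz L) (m L)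
      (by have := hV0 L; positivity) (hd L) hVL
    have e1 : (∫ x, F l x * F (k + 1 + max K l) x) = ∫ x, F l x * F L x * z L x := by
      rw [show k + 1 + max K l = L + 1 by lia]
      simp only [hFz, mul_assoc]
    rw [e1]
    set I := ∫ x, F l x * F L x
    set Z := ∫ x, z L x
    have hI : |I| ≤ 1 := hψ.abs_integral_le
    have h1 : |(∫ x, F l x * F L x * z L x)| ≤ |I * Z| +
        (q (m L) * d L + 2 * V L * (2 / q (m L))) := by
      have := abs_sub_abs_le_abs_sub (∫ x, F l x * F L x * z L x) (I * Z)
      linarith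
    have h2 : |I * Z| ≤ (1 - b L) * |I| + e L := by
      rw [abs_mul]
      have := (hK L (by lia)).1
      nlinarith [abs_nonneg I, he0 L]
    have h3 : 2 * V L * (2 / q (m L)) = 4 * V L / q (m L) := by ring
    linarith

end ContFractData

/-! ### Products of arc signs over return times -/

theorem arcProd_one (a : UnitAddCircle) (r : ℝ) (x : UnitAddCircle) :
    arcProd a r 1 x = arcSign r x := by
  simp [arcProd]

/-- If `m a` is the small rotation by `r`, then translating the union of the arcs `[j a, j a + r)`,
`j < m`, by `k a` changes it exactly in the union of the arcs `[j a, j a + 2 r)`, `j < k`. -/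
theorem arcProd_mul_translate {a : UnitAddCircle} {r : ℝ} {m : ℕ} (hr : 0 ≤ r) (hr1 : r ≤ 1 / 2)
    (hm : m • a = (r : UnitAddCircle)) (k : ℕ) (x : UnitAddCircle) :
    arcProd a r m x * arcProd a r m (x - k • a) = arcProd a (2 * r) k x := by
  have h1 := arcProd_add a r m k x
  rw [add_comm, arcProd_add a r k m x] at h1
  -- The product over `m + k` arcs splits in two ways; all factors square to `1`.
  have e : arcProd a r m x * arcProd a r m (x - k • a) =
      arcProd a r k x * arcProd a r k (x - m • a) := by
    linear_combination (arcProd a r k x * arcProd a r m x) * h1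
      - (arcProd a r m x * arcProd a r m (x - k • a)) * arcProd_mul_self a r k x
      + (arcProd a r k x * arcProd a r k (x - m • a)) * arcProd_mul_self a r m x
  rw [e, hm, arcProd, arcProd, arcProd, ← Finset.prod_mul_distrib]
  refine Finset.prod_congr rfl fun j _ => ?_
  rw [sub_right_comm, arcSign_mul_arcSign_sub hr hr (by linarith), two_mul]

section Transfer

variable (α : ℝ) (q n : ℕ → ℕ)

/-- The angle of the small rotation `x ↦ x + q_{n_k} α`. -/
noncomputable def returnAngle (k : ℕ) : ℝ := Int.fract (cfDen α (n k) * α)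

/-- The number `∑_{k < l} 2 q_{n_k}` of sign changes of `transferSign α q n l`. -/
def signChanges (l : ℕ) : ℕ := ∑ k ∈ Finset.range l, 2 * q (n k)

/-- The transfer function of the `k`-th piece of `J`, of length `2 * returnAngle α n k`. -/
noncomputable def pieceSign (k : ℕ) (x : UnitAddCircle) : ℝ :=
  arcProd (α : UnitAddCircle) (returnAngle α n k) (q (n k))
    (x - signChanges q n k • (α : UnitAddCircle))

/-- The transfer function of the union of the first `l` pieces of `J`. -/
noncomputable def transferSign (l : ℕ) (x : UnitAddCircle) : ℝ :=
  ∏ k ∈ Finset.range l, pieceSign α q n k x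

/-- The total length of the first `l` pieces of `J`. -/
noncomputable def partialLength (l : ℕ) : ℝ :=
  ∑ k ∈ Finset.range l, 2 * returnAngle α n k

/-- The time `1 + ∑_{k ≤ l} q_{n_k - 1}` after which the orbit of `0` is close to `x_∞`. -/
def translateTime (l : ℕ) : ℕ := 1 + ∑ k ∈ Finset.range (l + 1), q (n k - 1)

/-- The transfer function for the first `l` pieces of `J` together with their translates by
`x_∞`. -/
noncomputable def crossSign (l : ℕ) (x : UnitAddCircle) : ℝ :=
  transferSign α q n l x * transferSign α q n l (x - (xInfty α n : UnitAddCircle))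

/-- The sign cocycle of the symmetric difference of `J` and `J + x_∞`. -/
noncomputable def cocycleSign (x : UnitAddCircle) : ℝ :=
  arcSign (lengthJ α n) x * arcSign (lengthJ α n) (x - (xInfty α n : UnitAddCircle))

/-- The change of `transferSign α q n l x * transferSign α q n l (x - x_∞)` from `l` to `l + 1`. -/
noncomputable def stepSign (l : ℕ) (x : UnitAddCircle) : ℝ :=
  pieceSign α q n l x * pieceSign α q n l (x - (xInfty α n : UnitAddCircle))

end Transfer

/-- An admissible rotation number and subsequence, with the integer form of the continued fraction
expansion. -/
structure AdmissibleData (α : ℝ) (n a q : ℕ → ℕ) (p : ℕ → ℤ) : Prop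
    extends ContFractData α a q p where
  admissible : IsAdmissible α n

namespace AdmissibleData

variable {α : ℝ} {n a q : ℕ → ℕ} {p : ℕ → ℤ}

theorem two_le (h : AdmissibleData α n a q p) (k : ℕ) : 2 ≤ n k := by
  obtain ⟨j, hj⟩ := h.admissible.even k
  have := h.admissible.index_pos k
  lia

theorem index_add_le (h : AdmissibleData α n a q p) (k j : ℕ) : n k + 2 * j ≤ n (k + j) := by
  induction j with
  | zero => simp
  | succ j ih =>
    obtain ⟨u, hu⟩ := h.admissible.even (k + j)
    obtain ⟨v, hv⟩ := h.admissible.even (k + (j + 1))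
    have : n (k + j) < n (k + (j + 1)) := h.admissible.strictMono (by lia)
    lia

theorem two_pow_mul_den_index_le (h : AdmissibleData α n a q p) (k j : ℕ) :
    (2 : ℝ) ^ j * q (n k) ≤ q (n (k + j)) := by
  exact_mod_cast (h.two_pow_mul_den_le (n k) j).trans (h.den_mono (h.index_add_le k j))

theorem two_le_den_succ (h : AdmissibleData α n a q p) (k : ℕ) : (2 : ℝ) ≤ q (n k + 1) := by
  have h1 := h.two_mul_den_le 0
  have h2 := h.den_mono (show 0 + 2 ≤ n k + 1 by have := h.two_le k; lia)
  rw [h.den_zero] at h1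
  exact_mod_cast (by lia : 2 ≤ q (n k + 1))

theorem den_cast_pos (h : AdmissibleData α n a q p) (i : ℕ) : (0 : ℝ) < q i := by
  exact_mod_cast h.den_pos i

theorem returnAngle_eq (h : AdmissibleData α n a q p) (k : ℕ) :
    returnAngle α n k = q (n k) * α - p (n k) := by
  have h1 := h.error_lower (n k)
  rw [(h.admissible.even k).neg_one_pow, one_mul] at h1
  have h2 := h.abs_sub_le (n k)
  have hq := h.two_le_den_succ k
  have h3 : (1 : ℝ) / q (n k + 1) < 1 := by rw [div_lt_one (by linarith)]; linarith
  have h0 : (0 : ℝ) ≤ 1 / (2 * q (n k + 1)) := by positivity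
  rw [returnAngle, h.den_eq, Int.fract_eq_iff]
  exact ⟨by linarith, by linarith [le_abs_self ((q (n k) : ℝ) * α - p (n k))], p (n k), by ring⟩

theorem returnAngle_lower (h : AdmissibleData α n a q p) (k : ℕ) :
    1 / (2 * q (n k + 1) : ℝ) ≤ returnAngle α n k := by
  have h1 := h.error_lower (n k)
  rwa [(h.admissible.even k).neg_one_pow, one_mul, ← h.returnAngle_eq] at h1

theorem returnAngle_le (h : AdmissibleData α n a q p) (k : ℕ) :
    returnAngle α n k ≤ 1 / q (n k + 1) := by
  rw [h.returnAngle_eq]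
  exact (le_abs_self _).trans (h.abs_sub_le (n k))

theorem returnAngle_nonneg (k : ℕ) : 0 ≤ returnAngle α n k := Int.fract_nonneg _

theorem returnAngle_le_half (h : AdmissibleData α n a q p) (k : ℕ) :
    returnAngle α n k ≤ 1 / 2 :=
  (h.returnAngle_le k).trans (one_div_le_one_div_of_le two_pos (h.two_le_den_succ k))

theorem nsmul_eq_returnAngle (h : AdmissibleData α n a q p) (k : ℕ) :
    q (n k) • (α : UnitAddCircle) = (returnAngle α n k : UnitAddCircle) := by
  rw [h.returnAngle_eq, AddCircle.coe_sub, ← nsmul_eq_mul, AddCircle.coe_nsmul,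
    coe_intCast_eq_zero, sub_zero]

theorem inv_den_index_le (h : AdmissibleData α n a q p) (k j : ℕ) :
    1 / (q (n (k + j)) : ℝ) ≤ 1 / q (n k) * (1 / 2) ^ j := by
  have h1 := h.two_pow_mul_den_index_le k j
  have h2 := h.den_cast_pos (n k)
  calc 1 / (q (n (k + j)) : ℝ) ≤ 1 / (2 ^ j * q (n k)) :=
        one_div_le_one_div_of_le (by positivity) h1
    _ = _ := by rw [one_div_pow]; field_simp

theorem summable_geometric_half (c : ℝ) : Summable fun j : ℕ => c * (1 / 2 : ℝ) ^ j :=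
  (summable_geometric_of_lt_one (by norm_num) (by norm_num)).mul_left c

theorem tsum_geometric_half (c : ℝ) : ∑' j : ℕ, c * (1 / 2 : ℝ) ^ j = 2 * c := by
  rw [tsum_mul_left, tsum_geometric_of_lt_one (by norm_num) (by norm_num)]
  ring

theorem returnAngle_le_inv_den (h : AdmissibleData α n a q p) (k : ℕ) :
    returnAngle α n k ≤ 1 / q (n k) :=
  (h.returnAngle_le k).trans (one_div_le_one_div_of_le (h.den_cast_pos _)
    (by exact_mod_cast h.den_mono (Nat.le_succ _)))

theorem summable_returnAngle (h : AdmissibleData α n a q p) :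
    Summable fun k => 2 * returnAngle α n k := by
  refine Summable.mul_left 2 (Summable.of_nonneg_of_le (fun k => returnAngle_nonneg k) (fun k => ?_)
    (summable_geometric_half (1 / q (n 0))))
  have := h.inv_den_index_le 0 k
  rw [zero_add] at this
  exact (h.returnAngle_le_inv_den k).trans this

theorem lengthJ_eq : lengthJ α n = ∑' k, 2 * returnAngle α n k := rfl

theorem lengthJ_le_half (h : AdmissibleData α n a q p) : lengthJ α n ≤ 1 / 2 := by
  have h1 := lt_min_iff.1 h.admissible.length_lt
  linarith [h1.1, h1.2]

theorem partialLength_nonneg (l : ℕ) : 0 ≤ partialLength α n l :=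
  Finset.sum_nonneg fun k _ => mul_nonneg two_pos.le (returnAngle_nonneg k)

theorem partialLength_le (h : AdmissibleData α n a q p) (l : ℕ) :
    partialLength α n l ≤ lengthJ α n :=
  h.summable_returnAngle.sum_le_tsum _ fun k _ => mul_nonneg two_pos.le (returnAngle_nonneg k)

/-- The left end point of the `l`-th piece of `J` lies on the orbit of `0`. -/
theorem coe_partialLength (h : AdmissibleData α n a q p) (l : ℕ) :
    signChanges q n l • (α : UnitAddCircle) = (partialLength α n l : UnitAddCircle) := by
  induction l with
  | zero => simp [signChanges, partialLength]
  | succ l ih =>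
    rw [signChanges, Finset.sum_range_succ, ← signChanges, add_nsmul, ih, partialLength,
      partialLength, Finset.sum_range_succ, AddCircle.coe_add, mul_comm 2, mul_nsmul,
      h.nsmul_eq_returnAngle, two_mul, AddCircle.coe_add, two_nsmul]

theorem isUnitBounded_pieceSign (k : ℕ) : IsUnitBounded (pieceSign α q n k) :=
  (isUnitBounded_arcProd _ _ _).comp_sub _

theorem isUnitBounded_transferSign (l : ℕ) : IsUnitBounded (transferSign α q n l) :=
  .prod _ fun _ _ => isUnitBounded_pieceSign _

theorem transferSign_succ (l : ℕ) (x : UnitAddCircle) :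
    transferSign α q n (l + 1) x = transferSign α q n l x * pieceSign α q n l x :=
  Finset.prod_range_succ _ _

theorem transferSign_mul_self (l : ℕ) (x : UnitAddCircle) :
    transferSign α q n l x * transferSign α q n l x = 1 := by
  rw [transferSign, ← Finset.prod_mul_distrib]
  exact Finset.prod_eq_one fun k _ => arcProd_mul_self _ _ _ _

/-- After translation by `j` steps of the rotation, the `k`-th piece transfer function changes sign
exactly on `j` arcs of twice the return angle. -/
theorem pieceSign_mul_translate (h : AdmissibleData α n a q p) (k j : ℕ) (x : UnitAddCircle) :
    pieceSign α q n k x * pieceSign α q n k (x - j • (α : UnitAddCircle)) =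
      arcProd (α : UnitAddCircle) (2 * returnAngle α n k) j
        (x - (partialLength α n k : UnitAddCircle)) := by
  rw [pieceSign, pieceSign, sub_right_comm, arcProd_mul_translate (returnAngle_nonneg k)
    (h.returnAngle_le_half k) (h.nsmul_eq_returnAngle k), h.coe_partialLength]

/-- `transferSign α q n l` is a transfer function for the sign cocycle of the first `l` pieces
of `J`. -/
theorem transferSign_mul_sub (h : AdmissibleData α n a q p) (l : ℕ) (x : UnitAddCircle) :
    transferSign α q n l x * transferSign α q n l (x - (α : UnitAddCircle)) =
      arcSign (partialLength α n l) x := by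
  induction l with
  | zero => simp [transferSign, partialLength, arcSign]
  | succ l ih =>
    have h1 := h.pieceSign_mul_translate l 1 x
    rw [one_nsmul, arcProd_one] at h1
    have h2 : partialLength α n (l + 1) = partialLength α n l + 2 * returnAngle α n l :=
      Finset.sum_range_succ _ _
    have h3 := h.partialLength_le (l + 1)
    have h4 := h.lengthJ_le_half
    rw [h2, ← arcSign_mul_arcSign_sub (partialLength_nonneg l)
      (mul_nonneg two_pos.le (returnAngle_nonneg l)) (by linarith), ← ih, ← h1,
      transferSign_succ, transferSign_succ]
    ring

theorem transDist_pieceSign_le (h : AdmissibleData α n a q p) (k : ℕ) (t : UnitAddCircle) :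
    transDist (pieceSign α q n k) t ≤ 4 * q (n k) * ‖t‖ := by
  unfold pieceSign
  rw [transDist_comp_sub]
  exact transDist_arcProd_le (returnAngle_nonneg k) (h.returnAngle_le_half k) _ _

theorem transDist_transferSign_le (h : AdmissibleData α n a q p) (l : ℕ) (t : UnitAddCircle) :
    transDist (transferSign α q n l) t ≤ 2 * signChanges q n l * ‖t‖ := by
  refine (transDist_prod_le _ (fun _ _ => isUnitBounded_pieceSign _) t).trans ?_
  refine (Finset.sum_le_sum fun k _ => h.transDist_pieceSign_le k t).trans (le_of_eq ?_)
  rw [signChanges, ← Finset.sum_mul]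
  push_cast
  rw [Finset.mul_sum]
  congr 1
  exact Finset.sum_congr rfl fun k _ => by ring

theorem two_mul_returnAngle_le (h : AdmissibleData α n a q p) (k : ℕ) :
    2 * returnAngle α n k ≤ 1 := by linarith [h.returnAngle_le_half k]

theorem transDist_pieceSign_rotation (h : AdmissibleData α n a q p) (k : ℕ) :
    transDist (pieceSign α q n k) (α : UnitAddCircle) ≤ 4 * returnAngle α n k := by
  rw [← transDist_neg, transDist]
  have e : ∀ x, |pieceSign α q n k (x + -(α : UnitAddCircle)) - pieceSign α q n k x| =
      |1 - arcSign (2 * returnAngle α n k) (x - (partialLength α n k : UnitAddCircle))| := by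
    intro x
    have h1 := h.pieceSign_mul_translate k 1 x
    rw [one_nsmul, arcProd_one] at h1
    have h2 : pieceSign α q n k x * pieceSign α q n k x = 1 := arcProd_mul_self _ _ _ _
    rw [← h1, ← sub_eq_add_neg]
    rcases mul_self_eq_one_iff.1 h2 with h3 | h3 <;> rw [h3]
    · rw [abs_sub_comm, one_mul]
    · congr 1; ring
  simp only [e]
  rw [integral_sub_right_eq_self (fun x => |1 - arcSign (2 * returnAngle α n k) x|),
    integral_abs_one_sub_arcSign (mul_nonneg two_pos.le (returnAngle_nonneg k))
      (h.two_mul_returnAngle_le k)]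
  linarith

end AdmissibleData

namespace AdmissibleData

variable {α : ℝ} {n a q : ℕ → ℕ} {p : ℕ → ℤ}

/-! ### The translation by `x_∞` -/

theorem pred_add_one (h : AdmissibleData α n a q p) (k : ℕ) : n k - 1 + 1 = n k := by
  have := h.two_le k
  lia

theorem odd_pred (h : AdmissibleData α n a q p) (k : ℕ) : Odd (n k - 1) := by
  obtain ⟨j, hj⟩ := h.admissible.even k
  have := h.two_le k
  exact ⟨j - 1, by lia⟩

/-- As `n_k - 1` is odd, `q_{n_k - 1} α` lies just below an integer. -/
theorem circleDist_eq (h : AdmissibleData α n a q p) (k : ℕ) :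
    circleDist (cfDen α (n k - 1) * α) = -(q (n k - 1) * α - p (n k - 1)) := by
  have h1 := h.error_lower (n k - 1)
  rw [(h.odd_pred k).neg_one_pow] at h1
  have h0 : (0 : ℝ) ≤ 1 / (2 * q (n k - 1 + 1)) := by positivity
  have h2 := h.abs_sub_le (n k - 1)
  rw [h.pred_add_one] at h2
  have hq : (2 : ℝ) ≤ q (n k) := by
    have h3 := h.two_mul_den_le 0
    have h4 := h.den_mono (show 0 + 2 ≤ n k from h.two_le k)
    rw [h.den_zero] at h3
    exact_mod_cast (by lia : 2 ≤ q (n k))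
  have h3 : (1 : ℝ) / q (n k) ≤ 1 / 2 := one_div_le_one_div_of_le two_pos hq
  have e : ((q (n k - 1) * α : ℝ) : UnitAddCircle) =
      ((q (n k - 1) * α - p (n k - 1) : ℝ) : UnitAddCircle) := by
    rw [AddCircle.coe_sub, coe_intCast_eq_zero, sub_zero]
  rw [circleDist, h.den_eq, e, (AddCircle.norm_coe_eq_abs_iff (1 : ℝ) one_ne_zero).2
    (by rw [abs_one]; linarith), abs_of_nonpos (by linarith)]

theorem circleDist_le (h : AdmissibleData α n a q p) (k : ℕ) :
    circleDist (cfDen α (n k - 1) * α) ≤ 1 / q (n k) := by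
  rw [h.circleDist_eq]
  have h2 := h.abs_sub_le (n k - 1)
  rw [h.pred_add_one] at h2
  exact (neg_le_abs _).trans h2

theorem circleDist_nonneg (t : ℝ) : 0 ≤ circleDist t := norm_nonneg _

theorem circleDist_add_le (h : AdmissibleData α n a q p) (l k : ℕ) :
    circleDist (cfDen α (n (l + k) - 1) * α) ≤ 1 / q (n l) * (1 / 2) ^ k :=
  (h.circleDist_le _).trans (h.inv_den_index_le l k)

theorem summable_circleDist (h : AdmissibleData α n a q p) :
    Summable fun k => circleDist (cfDen α (n k - 1) * α) := by
  refine Summable.of_nonneg_of_le (fun k => circleDist_nonneg _) (fun k => ?_)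
    (summable_geometric_half (1 / q (n 0)))
  have := h.circleDist_add_le 0 k
  rwa [zero_add] at this

theorem tsum_circleDist_le (h : AdmissibleData α n a q p) (l : ℕ) :
    ∑' k, circleDist (cfDen α (n (k + l) - 1) * α) ≤ 2 * (1 / q (n l)) := by
  rw [← tsum_geometric_half]
  refine ((summable_nat_add_iff l).2 h.summable_circleDist).tsum_le_tsum (fun k => ?_)
    (summable_geometric_half _)
  rw [add_comm]
  exact h.circleDist_add_le l k

/-- The orbit point at time `translateTime q n l` is the `l`-th partial sum of the series that
defines `x_∞`. -/
theorem translateTime_nsmul (h : AdmissibleData α n a q p) (l : ℕ) :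
    translateTime q n l • (α : UnitAddCircle) =
      ((α - ∑ k ∈ Finset.range (l + 1), circleDist (cfDen α (n k - 1) * α) : ℝ) :
        UnitAddCircle) := by
  have key : ∀ m : ℕ, (∑ k ∈ Finset.range m, q (n k - 1)) • (α : UnitAddCircle) =
      ((-∑ k ∈ Finset.range m, circleDist (cfDen α (n k - 1) * α) : ℝ) : UnitAddCircle) := by
    intro m
    induction m with
    | zero => simp
    | succ m ih =>
      rw [Finset.sum_range_succ, add_nsmul, ih, Finset.sum_range_succ, neg_add, AddCircle.coe_add,
        h.circleDist_eq m, neg_neg, AddCircle.coe_sub, coe_intCast_eq_zero, sub_zero, ← nsmul_eq_mul,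
        AddCircle.coe_nsmul]
  rw [translateTime, add_nsmul, one_nsmul, key, ← AddCircle.coe_add, ← sub_eq_add_neg]

theorem norm_translateTime_sub_le (h : AdmissibleData α n a q p) (l : ℕ) :
    ‖translateTime q n l • (α : UnitAddCircle) - (xInfty α n : UnitAddCircle)‖ ≤
      2 * (1 / q (n (l + 1))) := by
  have h1 := h.summable_circleDist.sum_add_tsum_nat_add (l + 1)
  have h2 := h.tsum_circleDist_le (l + 1)
  have h3 : 0 ≤ ∑' k, circleDist (cfDen α (n (k + (l + 1)) - 1) * α) :=
    tsum_nonneg fun _ => circleDist_nonneg _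
  have e : α - ∑ k ∈ Finset.range (l + 1), circleDist (cfDen α (n k - 1) * α) - xInfty α n =
      ∑' k, circleDist (cfDen α (n (k + (l + 1)) - 1) * α) := by
    rw [xInfty]; linarith
  rw [h.translateTime_nsmul, ← AddCircle.coe_sub, e, UnitAddCircle.norm_eq]
  refine (round_le _ 0).trans ?_
  rw [Int.cast_zero, sub_zero, abs_of_nonneg h3]
  exact h2

theorem isUnitBounded_stepSign (l : ℕ) : IsUnitBounded (stepSign α q n l) :=
  (isUnitBounded_pieceSign l).mul ((isUnitBounded_pieceSign l).comp_sub _)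

theorem transDist_stepSign_rotation (h : AdmissibleData α n a q p) (l : ℕ) :
    transDist (stepSign α q n l) (α : UnitAddCircle) ≤ 8 * returnAngle α n l := by
  refine (transDist_mul_le (isUnitBounded_pieceSign l)
    ((isUnitBounded_pieceSign l).comp_sub _) _).trans ?_
  rw [transDist_comp_sub]
  linarith [h.transDist_pieceSign_rotation (q := q) l]

/-- Up to a small error, `J + x_∞` may be replaced by a translate along the orbit when integrating
`stepSign`. -/
theorem abs_integral_stepSign_sub_le (h : AdmissibleData α n a q p) (l : ℕ)
    (hsep : ∀ j, 0 < j → j < translateTime q n l →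
      2 * returnAngle α n l ≤ ‖j • (α : UnitAddCircle)‖) :
    |(∫ x, stepSign α q n l x) - (1 - 4 * translateTime q n l * returnAngle α n l)| ≤
      8 * q (n l) / q (n (l + 1)) := by
  have hp : IsUnitBounded (pieceSign α q n l) := isUnitBounded_pieceSign l
  set c : UnitAddCircle := translateTime q n l • (α : UnitAddCircle) with hc
  set y : UnitAddCircle := (xInfty α n : UnitAddCircle) with hy
  have e : (∫ x, pieceSign α q n l x * pieceSign α q n l (x - c)) =
      1 - 4 * translateTime q n l * returnAngle α n l := by
    simp only [hc, h.pieceSign_mul_translate]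
    rw [integral_sub_right_eq_self (arcProd (α : UnitAddCircle) (2 * returnAngle α n l)
      (translateTime q n l)), integral_arcProd (mul_nonneg two_pos.le (returnAngle_nonneg l))
      (h.two_mul_returnAngle_le l) _ hsep]
    ring
  rw [← e]
  unfold stepSign
  rw [← integral_sub (hp.mul (hp.comp_sub _)).integrable (hp.mul (hp.comp_sub _)).integrable]
  have h1 := abs_integral_mul_translate_sub_le hp (hp.comp_sub c) (c - y)
  rw [transDist_comp_sub] at h1
  have e2 : ∀ x, x + (c - y) - c = x - y := fun x => by abel
  simp only [e2, mul_sub] at h1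
  refine h1.trans ((h.transDist_pieceSign_le l _).trans ?_)
  have h2 := h.norm_translateTime_sub_le l
  calc 4 * q (n l) * ‖c - y‖ ≤ 4 * q (n l) * (2 * (1 / q (n (l + 1)))) := by gcongr
    _ = _ := by ring

/-! ### Growth of the denominators -/

theorem term_eq_two (h : AdmissibleData α n a q p) (k : ℕ) : a (n k) = 2 := by
  have h1 := (h.admissible.term_eq_two k).1
  rw [← h.pred_add_one k, h.term_eq, h.pred_add_one] at h1
  exact_mod_cast h1

theorem den_index_eq (h : AdmissibleData α n a q p) (k : ℕ) :
    q (n k) = 2 * q (n k - 1) + q (n k - 2) := by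
  obtain ⟨i, hi⟩ := Nat.exists_eq_add_of_le' (h.two_le k)
  have h2 := h.term_eq_two k
  rw [hi] at h2 ⊢
  rw [h.den_succ, h2]
  rfl

/-- This bound, which uses `a_{n_k} = 2`, makes `translateTime` a definite proportion of `q_{n_k}`. -/
theorem den_index_le (h : AdmissibleData α n a q p) (k : ℕ) : q (n k) ≤ 3 * q (n k - 1) := by
  have := h.den_mono (show n k - 2 ≤ n k - 1 by lia)
  have := h.den_index_eq k
  lia

theorem signChanges_succ_lt (h : AdmissibleData α n a q p) (l : ℕ) :
    1 + signChanges q n (l + 1) < q (n l + 1) := by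
  have := h.admissible.sum_den_lt l
  simp only [h.den_eq] at this
  rw [signChanges]
  exact_mod_cast this

/-- The bound rests on `a_{n_{l+1}} = 2`: both `q_{n_{l+1} - 1}` and the sum of the earlier terms
are at most half of `q_{n_{l+1}}`. -/
theorem translateTime_le (h : AdmissibleData α n a q p) (l : ℕ) :
    translateTime q n (l + 1) ≤ q (n (l + 1)) := by
  have h1 := h.signChanges_succ_lt l
  have h2 := h.den_mono (show n l + 1 ≤ n (l + 1) - 1 by have := h.index_add_le l 1; lia)
  have h3 := h.den_index_eq (l + 1)
  have h4 : ∑ k ∈ Finset.range (l + 1), q (n k - 1) ≤ signChanges q n (l + 1) := by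
    refine Finset.sum_le_sum fun k _ => ?_
    have := h.den_mono (show n k - 1 ≤ n k by lia)
    lia
  rw [translateTime, Finset.sum_range_succ]
  lia

theorem den_le_translateTime (l : ℕ) :
    q (n l - 1) ≤ translateTime q n l := by
  rw [translateTime, Finset.sum_range_succ]
  lia

theorem tendsto_term_index (h : AdmissibleData α n a q p) :
    Tendsto (fun l => (a (n l + 1) : ℝ)) atTop atTop := by
  simpa only [h.term_eq] using h.admissible.tendsto_term

/-- The denominators `q_{n_l}` are lacunary on a logarithmic scale; any fixed exponent is possible. -/
theorem den_succ_pow_le (h : AdmissibleData α n a q p) :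
    ∀ᶠ l in atTop, (q (n l + 1) : ℝ) ^ 8 ≤ q (n (l + 1)) := by
  have h1 := h.admissible.log_den_isLittleO.bound (show (0 : ℝ) < 1 / 8 by norm_num)
  filter_upwards [h1] with l hl
  simp only [h.den_eq, Real.norm_eq_abs] at hl
  rw [abs_of_nonneg (Real.log_nonneg (h.one_le_den _)),
    abs_of_nonneg (Real.log_nonneg (h.one_le_den _))] at hl
  rw [← Real.log_le_log_iff (pow_pos (h.den_cast_pos _) 8) (h.den_cast_pos _), Real.log_pow]
  push_cast
  linarith

theorem tendsto_den (h : AdmissibleData α n a q p) : Tendsto q atTop atTop := by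
  refine tendsto_atTop_mono' atTop (f₁ := fun i => i / 2) (Eventually.of_forall fun i => ?_)
    (Nat.tendsto_div_const_atTop two_ne_zero)
  have h1 := h.two_pow_mul_den_le 0 (i / 2)
  have h2 := h.den_mono (show 0 + 2 * (i / 2) ≤ i by lia)
  rw [h.den_zero, mul_one] at h1
  exact (Nat.lt_two_pow_self.le.trans h1).trans h2

/-- The denominators grow at most quadratically from one index to the next. -/
theorem den_succ_le_sq (h : AdmissibleData α n a q p) :
    ∀ᶠ i in atTop, q (i + 1) ≤ q i ^ 2 := by
  have h1 := h.admissible.term_succ_isLittleO.bound one_pos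
  have h2 := h.tendsto_den.eventually (eventually_ge_atTop 3)
  filter_upwards [h1, h2] with i hi hq
  simp only [h.den_eq, h.term_eq, Real.norm_eq_abs, one_mul, Nat.abs_cast] at hi
  have hq3 : (3 : ℝ) ≤ q i := by exact_mod_cast hq
  have hlog1 : 1 ≤ Real.log (q i) := by
    rw [Real.le_log_iff_exp_le (by linarith)]
    linarith [Real.exp_one_lt_d9]
  rw [abs_of_nonneg (Real.log_nonneg hlog1)] at hi
  have h3 := Real.log_le_sub_one_of_pos (show 0 < Real.log (q i) by linarith)
  have h4 := Real.log_le_sub_one_of_pos (show (0 : ℝ) < q i by linarith)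
  have h5 : (a (i + 1) : ℝ) + 1 ≤ q i := by linarith
  have h6 : a (i + 1) + 1 ≤ q i := by exact_mod_cast h5
  exact (h.den_succ_le i).trans (by rw [pow_two]; exact Nat.mul_le_mul_right _ h6)

/-- There is a denominator between the fourth and the square root of `q_{n_l}`. -/
theorem exists_scale (h : AdmissibleData α n a q p) :
    ∃ m : ℕ → ℕ, ∀ᶠ l in atTop, q (m l) ^ 2 ≤ q (n l) ∧ q (n l) ≤ q (m l) ^ 4 := by
  have hex : ∀ Y : ℕ, 1 ≤ Y → ∃ i, q i ^ 2 ≤ Y ∧ Y < q (i + 1) ^ 2 := by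
    intro Y hY
    by_contra! hcon
    have hall : ∀ i, q i ^ 2 ≤ Y := by
      intro i
      induction i with
      | zero => simpa [h.den_zero] using hY
      | succ i ih => exact hcon i ih
    obtain ⟨i, hi⟩ := (h.tendsto_den.eventually (eventually_gt_atTop Y)).exists
    nlinarith [hall i]
  -- `m Y` is an index with `q (m Y) ^ 2 ≤ Y < q (m Y + 1) ^ 2`.
  choose! m hm1 hm2 using hex
  obtain ⟨i₀, hi₀⟩ := eventually_atTop.1 h.den_succ_le_sq
  have ht : Tendsto (fun l => q (n l)) atTop atTop :=
    h.tendsto_den.comp h.admissible.strictMono.tendsto_atTop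
  refine ⟨fun l => m (q (n l)), ?_⟩
  filter_upwards [ht.eventually (eventually_ge_atTop (q i₀ ^ 2))] with l hl
  have hY := h.den_pos (n l)
  refine ⟨hm1 _ hY, ?_⟩
  have h1 := hm2 _ hY
  have hi : i₀ ≤ m (q (n l)) := by
    by_contra! hlt
    have h2 := h.den_mono (show m (q (n l)) + 1 ≤ i₀ by lia)
    have := Nat.pow_le_pow_left h2 2
    lia
  have h3 := Nat.pow_le_pow_left (hi₀ _ hi) 2
  rw [← pow_mul] at h3
  exact h1.le.trans h3

end AdmissibleData

namespace AdmissibleData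

variable {α : ℝ} {n a q : ℕ → ℕ} {p : ℕ → ℤ}

/-! ### The sign cocycle of `J` and its translate -/

theorem isUnitBounded_crossSign (l : ℕ) : IsUnitBounded (crossSign α q n l) :=
  (isUnitBounded_transferSign l).mul ((isUnitBounded_transferSign l).comp_sub _)

theorem isUnitBounded_cocycleSign : IsUnitBounded (cocycleSign α n) :=
  (isUnitBounded_arcSign _).mul ((isUnitBounded_arcSign _).comp_sub _)

theorem crossSign_mul_self (l : ℕ) (x : UnitAddCircle) :
    crossSign α q n l x * crossSign α q n l x = 1 := by
  rw [crossSign, mul_mul_mul_comm, transferSign_mul_self, transferSign_mul_self, one_mul]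

theorem crossSign_succ (l : ℕ) (x : UnitAddCircle) :
    crossSign α q n (l + 1) x = crossSign α q n l x * stepSign α q n l x := by
  rw [crossSign, crossSign, stepSign, transferSign_succ, transferSign_succ]
  ring

theorem transDist_crossSign_le (h : AdmissibleData α n a q p) (l : ℕ) (t : UnitAddCircle) :
    transDist (crossSign α q n l) t ≤ 4 * signChanges q n l * ‖t‖ := by
  refine (transDist_mul_le (isUnitBounded_transferSign l)
    ((isUnitBounded_transferSign l).comp_sub _) _).trans ?_
  rw [transDist_comp_sub]
  linarith [h.transDist_transferSign_le l t]

theorem integral_abs_cocycleSign_sub_le (h : AdmissibleData α n a q p) (l : ℕ) :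
    ∫ x, |cocycleSign α n x - crossSign α q n l x * crossSign α q n l (x - (α : UnitAddCircle))| ≤
      4 * (lengthJ α n - partialLength α n l) := by
  have hU := isUnitBounded_arcSign (lengthJ α n)
  have hU' := isUnitBounded_arcSign (partialLength α n l)
  have e : ∀ x, crossSign α q n l x * crossSign α q n l (x - (α : UnitAddCircle)) =
      arcSign (partialLength α n l) x *
        arcSign (partialLength α n l) (x - (xInfty α n : UnitAddCircle)) := by
    intro x
    rw [← h.transferSign_mul_sub, ← h.transferSign_mul_sub, crossSign, crossSign,
      sub_right_comm x (α : UnitAddCircle)]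
    ring
  have hle : ∀ x, |cocycleSign α n x -
      crossSign α q n l x * crossSign α q n l (x - (α : UnitAddCircle))| ≤
      |arcSign (lengthJ α n) (x - (xInfty α n : UnitAddCircle)) -
        arcSign (partialLength α n l) (x - (xInfty α n : UnitAddCircle))| +
      |arcSign (lengthJ α n) x - arcSign (partialLength α n l) x| := by
    intro x
    rw [e, cocycleSign]
    exact abs_mul_sub_mul_le (hU.abs_le _) (hU'.abs_le _)
  have h1 := integral_abs_arcSign_sub_le (partialLength_nonneg (α := α) (n := n) l)
    (sub_nonneg.2 (h.partialLength_le l)) (by linarith [h.lengthJ_le_half])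
  rw [add_sub_cancel] at h1
  have i1 := hU.integrable_abs_sub hU'
  have i2 := (hU.comp_sub (xInfty α n : UnitAddCircle)).integrable_abs_sub
    (hU'.comp_sub (xInfty α n : UnitAddCircle))
  refine (integral_mono (isUnitBounded_cocycleSign.integrable_abs_sub
    ((isUnitBounded_crossSign l).mul ((isUnitBounded_crossSign l).comp_sub _)))
    (i2.add i1) hle).trans ?_
  simp only [Pi.add_apply]
  rw [integral_add i2 i1,
    integral_sub_right_eq_self (fun x => |arcSign (lengthJ α n) x - arcSign (partialLength α n l) x|)]
  linarith

/-- The part of `J` left after `l` pieces has length `o(1 / q_{n_l})`, because `a_{n_k + 1} → ∞`. -/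
theorem tendsto_den_mul_remainder (h : AdmissibleData α n a q p) :
    Tendsto (fun l => q (n l) * (4 * (lengthJ α n - partialLength α n l))) atTop (nhds 0) := by
  rw [Metric.tendsto_atTop]
  intro ε hε
  obtain ⟨l₀, hl₀⟩ := eventually_atTop.1
    (h.tendsto_term_index.eventually (eventually_ge_atTop (32 / ε)))
  refine ⟨l₀, fun l hl => ?_⟩
  have h0 : 0 ≤ lengthJ α n - partialLength α n l := sub_nonneg.2 (h.partialLength_le l)
  have hq := h.den_cast_pos (n l)
  have h1 : lengthJ α n - partialLength α n l = ∑' k, 2 * returnAngle α n (k + l) := by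
    have := h.summable_returnAngle.sum_add_tsum_nat_add l
    rw [lengthJ_eq, partialLength]
    linarith
  have h2 : ∑' k, 2 * returnAngle α n (k + l) ≤ ε / (8 * q (n l)) := by
    have e : ε / (8 * q (n l)) = 2 * (2 * (ε / 32 * (1 / q (n l)))) := by ring
    rw [e, ← tsum_geometric_half]
    refine ((summable_nat_add_iff l).2 h.summable_returnAngle).tsum_le_tsum (fun k => ?_)
      (summable_geometric_half _)
    have hA := hl₀ (l + k) (by lia)
    have hA0 : 0 < 32 / ε := by positivity
    have hB : (a (n (l + k) + 1) : ℝ) * q (n (l + k)) ≤ q (n (l + k) + 1) := by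
      exact_mod_cast h.term_mul_den_le _
    have hC := h.inv_den_index_le l k
    have hD := h.den_cast_pos (n (l + k))
    rw [add_comm k l]
    calc 2 * returnAngle α n (l + k) ≤ 2 * (1 / q (n (l + k) + 1)) := by
          gcongr; exact h.returnAngle_le _
      _ ≤ 2 * (1 / (32 / ε * q (n (l + k)))) := by
          gcongr
          exact (mul_le_mul_of_nonneg_right hA hD.le).trans hB
      _ = 2 * (ε / 32 * (1 / q (n (l + k)))) := by field_simp
      _ ≤ 2 * (ε / 32 * (1 / q (n l) * (1 / 2) ^ k)) := by gcongr
      _ = _ := by ring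
  rw [Real.dist_eq, sub_zero, abs_of_nonneg (by positivity), h1]
  calc q (n l) * (4 * ∑' k, 2 * returnAngle α n (k + l))
      ≤ q (n l) * (4 * (ε / (8 * q (n l)))) := by gcongr
    _ = ε / 2 := by field_simp; norm_num
    _ < ε := by linarith

theorem two_pow_le_den_succ (h : AdmissibleData α n a q p) (l : ℕ) :
    (2 : ℝ) ^ l ≤ q (n l + 1) := by
  have h1 := h.two_pow_mul_den_index_le 0 l
  rw [zero_add] at h1
  have h2 : (q (n l) : ℝ) ≤ q (n l + 1) := by exact_mod_cast h.den_mono (Nat.le_succ _)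
  have h3 := h.one_le_den (n 0)
  have h4 : (2 : ℝ) ^ l * 1 ≤ 2 ^ l * q (n 0) := by gcongr
  linarith

theorem inv_den_succ_le (h : AdmissibleData α n a q p) (l : ℕ) :
    1 / (q (n l + 1) : ℝ) ≤ (1 / 2) ^ l := by
  rw [one_div_pow]
  exact one_div_le_one_div_of_le (by positivity) (h.two_pow_le_den_succ l)

theorem div_le_inv_of_pow_le {x y : ℝ} (hx : 1 ≤ x) (h : x ^ 8 ≤ y) : x / y ≤ 1 / x := by
  have h1 : x ^ 2 ≤ x ^ 8 := pow_le_pow_right₀ hx (by norm_num)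
  have hx0 : 0 < x := by linarith
  rw [div_le_div_iff₀ (by nlinarith) hx0]
  nlinarith

theorem signChanges_succ_le (h : AdmissibleData α n a q p) (l : ℕ) :
    (signChanges q n (l + 1) : ℝ) ≤ q (n l + 1) := by
  have := h.signChanges_succ_lt l
  exact_mod_cast (by lia : signChanges q n (l + 1) ≤ q (n l + 1))

theorem tendsto_signChanges_div (h : AdmissibleData α n a q p) :
    Tendsto (fun l => (4 * signChanges q n l : ℝ) / q (n l)) atTop (nhds 0) := by
  rw [← tendsto_add_atTop_iff_nat 1]
  have hg : Tendsto (fun l : ℕ => 4 * (1 / 2 : ℝ) ^ l) atTop (nhds 0) := by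
    simpa using (tendsto_pow_atTop_nhds_zero_of_lt_one (r := (1 / 2 : ℝ)) (by norm_num)
      (by norm_num)).const_mul 4
  refine squeeze_zero' (Eventually.of_forall fun l => by positivity) ?_ hg
  filter_upwards [h.den_succ_pow_le] with l hl
  have hq := h.den_cast_pos (n (l + 1))
  calc (4 * signChanges q n (l + 1) : ℝ) / q (n (l + 1))
      ≤ 4 * q (n l + 1) / q (n (l + 1)) := by gcongr; exact_mod_cast h.signChanges_succ_le l
    _ = 4 * (q (n l + 1) / q (n (l + 1))) := by ring
    _ ≤ 4 * (1 / 2) ^ l := by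
      gcongr
      exact (div_le_inv_of_pow_le (h.one_le_den _) hl).trans (h.inv_den_succ_le l)

/-- The errors made in decorrelating successive factors are summable. The exponent `8` leaves room
for a scale `q (m l)` much larger than the number of sign changes so far and much smaller than
`q_{n_l}`. -/
theorem summable_errors (h : AdmissibleData α n a q p) {m : ℕ → ℕ}
    (hm : ∀ᶠ l in atTop, q (m l) ^ 2 ≤ q (n l) ∧ q (n l) ≤ q (m l) ^ 4) :
    Summable fun l => q (m l) * (8 * returnAngle α n l) +
      4 * (4 * signChanges q n l : ℝ) / q (m l) + 8 * q (n l) / q (n (l + 1)) := by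
  rw [← summable_nat_add_iff 1]
  refine (summable_geometric_half 32).of_norm_bounded_eventually_nat ?_
  filter_upwards [h.den_succ_pow_le, (tendsto_add_atTop_nat 1).eventually h.den_succ_pow_le,
    (tendsto_add_atTop_nat 1).eventually hm] with l h1 h2 h3
  set X := (q (n l + 1) : ℝ) with hX
  set Q := (q (m (l + 1)) : ℝ) with hQ
  set Y := (q (n (l + 1)) : ℝ) with hY
  have hX1 : 1 ≤ X := h.one_le_den _
  have hQ0 : 0 < Q := h.den_cast_pos _
  have hY0 : 0 < Y := h.den_cast_pos _
  have hQY : Q ^ 2 ≤ Y := by simp only [hQ, hY]; exact_mod_cast h3.1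
  have hYQ : Y ≤ Q ^ 4 := by simp only [hQ, hY]; exact_mod_cast h3.2
  have hXQ : X ^ 2 ≤ Q := by
    have : (X ^ 2) ^ 4 ≤ Q ^ 4 := by rw [← pow_mul]; exact h1.trans hYQ
    exact le_of_pow_le_pow_left₀ (by norm_num) hQ0.le this
  have hδ : returnAngle α n (l + 1) ≤ 1 / Y := h.returnAngle_le_inv_den _
  have hδ0 := returnAngle_nonneg (α := α) (n := n) (l + 1)
  have t1 : Q * (8 * returnAngle α n (l + 1)) ≤ 8 * (1 / X) := by
    calc Q * (8 * returnAngle α n (l + 1)) ≤ Q * (8 * (1 / Q ^ 2)) := by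
          gcongr
          exact hδ.trans (one_div_le_one_div_of_le (by positivity) hQY)
      _ = 8 * (1 / Q) := by field_simp
      _ ≤ 8 * (1 / X) := by gcongr; nlinarith
  have t2 : 4 * (4 * signChanges q n (l + 1) : ℝ) / Q ≤ 16 * (1 / X) := by
    calc 4 * (4 * signChanges q n (l + 1) : ℝ) / Q ≤ 4 * (4 * X) / X ^ 2 := by
          gcongr
          exact h.signChanges_succ_le l
      _ = 16 * (1 / X) := by field_simp; norm_num
  have t3 : 8 * Y / q (n (l + 1 + 1)) ≤ 8 * (1 / X) := by
    have hXX : X ≤ q (n (l + 1) + 1) := by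
      simp only [hX]
      exact_mod_cast h.den_mono (by have := h.index_add_le l 1; lia)
    have hYX : Y ≤ q (n (l + 1) + 1) := by
      simp only [hY]
      exact_mod_cast h.den_mono (Nat.le_succ _)
    have hq := h.den_cast_pos (n (l + 1 + 1))
    calc 8 * Y / q (n (l + 1 + 1)) ≤ 8 * q (n (l + 1) + 1) / q (n (l + 1 + 1)) := by gcongr
      _ = 8 * (q (n (l + 1) + 1) / q (n (l + 1 + 1))) := by ring
      _ ≤ 8 * (1 / q (n (l + 1) + 1)) := by
          exact mul_le_mul_of_nonneg_left (div_le_inv_of_pow_le (h.one_le_den _) h2) (by norm_num)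
      _ ≤ 8 * (1 / X) := by gcongr
  have hX2 := h.inv_den_succ_le l
  rw [Real.norm_eq_abs, abs_of_nonneg (by positivity)]
  linarith

/-- The total measure of the sets where `stepSign` is `-1` diverges, because `∑ 1 / a_{n_k + 1}`
does. -/
theorem tendsto_sum_translateTime_mul (h : AdmissibleData α n a q p) :
    Tendsto (fun K => ∑ k ∈ Finset.range K, 4 * translateTime q n k * returnAngle α n k)
      atTop atTop := by
  have h1 := h.admissible.sum_inv_eq_top.const_mul_atTop (show (0 : ℝ) < 1 / 3 by norm_num)
  refine tendsto_atTop_mono (fun K => ?_) h1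
  rw [Finset.mul_sum]
  refine Finset.sum_le_sum fun k _ => ?_
  rw [h.term_eq]
  have hd : (q (n k) : ℝ) ≤ 3 * q (n k - 1) := by exact_mod_cast h.den_index_le k
  have ht : (q (n k - 1) : ℝ) ≤ translateTime q n k := by exact_mod_cast den_le_translateTime k
  have ha1 : (1 : ℝ) ≤ a (n k + 1) := by exact_mod_cast h.one_le_term _
  have hq := h.den_cast_pos (n k)
  have hq' := h.den_cast_pos (n k + 1)
  have hs : (q (n k + 1) : ℝ) ≤ (a (n k + 1) + 1) * q (n k) := by exact_mod_cast h.den_succ_le _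
  calc 1 / 3 * (a (n k + 1) : ℝ)⁻¹ = 4 * (q (n k) / 3) * (1 / (2 * (2 * a (n k + 1) * q (n k)))) := by
        field_simp; norm_num
    _ ≤ 4 * translateTime q n k * (1 / (2 * q (n k + 1))) := by
        gcongr
        · linarith
        · nlinarith
    _ ≤ 4 * translateTime q n k * returnAngle α n k := by
        gcongr
        exact h.returnAngle_lower k

theorem eventually_integral_stepSign (h : AdmissibleData α n a q p) :
    ∀ᶠ l in atTop, 4 * translateTime q n l * returnAngle α n l ≤ 1 ∧
      |∫ x, stepSign α q n l x| ≤ 1 - 4 * translateTime q n l * returnAngle α n l +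
        8 * q (n l) / q (n (l + 1)) := by
  filter_upwards [h.tendsto_term_index.eventually (eventually_ge_atTop 4),
    eventually_ge_atTop 1] with l ha hl
  obtain ⟨l, rfl⟩ := Nat.exists_eq_add_of_le' hl
  have hM := h.translateTime_le l
  have hM' : (translateTime q n (l + 1) : ℝ) ≤ q (n (l + 1)) := by exact_mod_cast hM
  have hq := h.den_cast_pos (n (l + 1))
  have hq' := h.den_cast_pos (n (l + 1) + 1)
  have hs : (a (n (l + 1) + 1) : ℝ) * q (n (l + 1)) ≤ q (n (l + 1) + 1) := by
    exact_mod_cast h.term_mul_den_le _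
  have h4 : 4 * (q (n (l + 1)) : ℝ) ≤ q (n (l + 1) + 1) := by nlinarith
  have hδ := h.returnAngle_le (l + 1)
  have hδ0 := returnAngle_nonneg (α := α) (n := n) (l + 1)
  have hb : 4 * translateTime q n (l + 1) * returnAngle α n (l + 1) ≤ 1 := by
    calc 4 * translateTime q n (l + 1) * returnAngle α n (l + 1)
        ≤ 4 * q (n (l + 1)) * (1 / q (n (l + 1) + 1)) := by gcongr
      _ ≤ 1 := by rw [mul_one_div, div_le_one hq']; exact h4
  refine ⟨hb, ?_⟩
  have h5 := h.abs_integral_stepSign_sub_le (l + 1) fun j hj0 hj => by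
    refine le_trans ?_ (h.le_norm_nsmul (n (l + 1)) hj0 (by lia))
    have h6 : 4 * (1 / (q (n (l + 1) + 1) : ℝ)) ≤ 1 / q (n (l + 1)) := by
      rw [mul_one_div, div_le_div_iff₀ hq' hq]; linarith
    linarith
  have h7 := abs_sub_abs_le_abs_sub (∫ x, stepSign α q n (l + 1) x)
    (1 - 4 * translateTime q n (l + 1) * returnAngle α n (l + 1))
  rw [abs_of_nonneg (show 0 ≤ 1 - 4 * translateTime q n (l + 1) * returnAngle α n (l + 1)
    by linarith)] at h7
  linarith

/-- The sign cocycle of the symmetric difference of `J` and `J + x_∞` is not a measurable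
coboundary. -/
theorem not_coboundary (h : AdmissibleData α n a q p) {u : UnitAddCircle → ℝ}
    (hu : IsUnitBounded u) (hu2 : ∀ᵐ x, u x * u x = 1)
    (hcob : ∀ x, u x = cocycleSign α n x * u (x - (α : UnitAddCircle))) : False := by
  obtain ⟨m, hm⟩ := h.exists_scale
  have hV0 : ∀ l, (0 : ℝ) ≤ 4 * signChanges q n l := fun l => by positivity
  have hVm : Monotone fun l => (4 * signChanges q n l : ℝ) := by
    refine monotone_nat_of_le_succ fun l => ?_
    have : signChanges q n l ≤ signChanges q n (l + 1) := by
      rw [signChanges, signChanges, Finset.sum_range_succ]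
      exact Nat.le_add_right _ _
    have : (signChanges q n l : ℝ) ≤ signChanges q n (l + 1) := by exact_mod_cast this
    linarith
  have hunc := h.tendsto_integral_mul_zero (F := crossSign α q n) (z := stepSign α q n) (m := m)
    isUnitBounded_crossSign isUnitBounded_stepSign crossSign_succ hV0 hVm h.transDist_crossSign_le
    h.transDist_stepSign_rotation (h.eventually_integral_stepSign.mono fun _ hl => hl.2)
    (fun l => mul_nonneg (by positivity) (returnAngle_nonneg l))
    (h.eventually_integral_stepSign.mono fun _ hl => hl.1) (fun l => by positivity)
    h.tendsto_sum_translateTime_mul (h.summable_errors hm)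
  exact h.false_of_sign_cocycle (F := crossSign α q n) (m := n) isUnitBounded_crossSign
    crossSign_mul_self isUnitBounded_cocycleSign hu hu2 hcob hV0 h.transDist_crossSign_le
    h.integral_abs_cocycleSign_sub_le
    (tendsto_natCast_atTop_atTop.comp (h.tendsto_den.comp h.admissible.strictMono.tendsto_atTop))
    h.tendsto_signChanges_div h.tendsto_den_mul_remainder hunc

end AdmissibleData

/-! ### Measurable solutions of the three cohomological equations -/

theorem ergodic_rotation {α : ℝ} (hα : Irrational α) :
    Ergodic (fun x : UnitAddCircle => x + (α : UnitAddCircle)) volume := by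
  rw [AddCircle.ergodic_add_right, ← AddCircle.denseRange_zsmul_iff,
    AddCircle.denseRange_zsmul_coe_iff]
  simpa using hα

theorem exists_abs_ae_eq_of_sign_cocycle {α : ℝ} (hα : Irrational α) {s u : UnitAddCircle → ℝ}
    (hu : Measurable u) (hs : ∀ x, |s x| = 1)
    (hcob : ∀ x, u x = s x * u (x - (α : UnitAddCircle))) : ∃ c, ∀ᵐ x, |u x| = c := by
  refine (ergodic_rotation hα).ae_eq_const_of_ae_eq_comp_ae (g := fun x => |u x|)
    hu.abs.aestronglyMeasurable (ae_of_all _ fun x => ?_)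
  have := hcob (x + (α : UnitAddCircle))
  rw [add_sub_cancel_right] at this
  simp only [Function.comp]
  rw [this, abs_mul, hs, one_mul]

theorem abs_arcSign (r : ℝ) (x : UnitAddCircle) : |arcSign r x| = 1 := by
  rcases arcSign_eq_or r x with h | h <;> simp [h]

theorem abs_cocycleSign (α : ℝ) (n : ℕ → ℕ) (x : UnitAddCircle) : |cocycleSign α n x| = 1 := by
  rw [cocycleSign, abs_mul, abs_arcSign, abs_arcSign, one_mul]

namespace AdmissibleData

variable {α : ℝ} {n a q : ℕ → ℕ} {p : ℕ → ℤ} {u : UnitAddCircle → ℝ}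

theorem ae_eq_zero_of_cocycleSign (h : AdmissibleData α n a q p) (hu : Measurable u)
    (hcob : ∀ x, u x = cocycleSign α n x * u (x - (α : UnitAddCircle))) : ∀ᵐ x, u x = 0 := by
  obtain ⟨c, hc⟩ := exists_abs_ae_eq_of_sign_cocycle h.admissible.irrational hu
    (abs_cocycleSign α n) hcob
  rcases eq_or_ne c 0 with rfl | hc0
  · exact hc.mono fun x hx => abs_eq_zero.1 hx
  exfalso
  -- Normalizing `u` to a function with values `± 1` keeps the equation valid everywhere.
  refine h.not_coboundary (u := fun x => u x / |u x|) ⟨hu.div hu.abs, fun x => ?_⟩ ?_ fun x => ?_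
  · rw [abs_div, abs_abs]
    exact div_self_le_one _
  · filter_upwards [hc] with x hx
    have : |u x| ≠ 0 := by rwa [hx]
    rw [div_mul_div_comm, abs_mul_abs_self, div_self]
    exact mul_self_ne_zero.2 (abs_ne_zero.1 this)
  · rw [hcob x, abs_mul, abs_cocycleSign, one_mul, mul_div_assoc]

/-- If `u` solves the equation for `J`, then `u x * u (x - x_∞)` solves it for the symmetric
difference of `J` and `J + x_∞`. -/
theorem ae_eq_zero_of_arcSign (h : AdmissibleData α n a q p) (hu : Measurable u)
    (hcob : ∀ x, u x = arcSign (lengthJ α n) x * u (x - (α : UnitAddCircle))) :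
    ∀ᵐ x, u x = 0 := by
  obtain ⟨c, hc⟩ := exists_abs_ae_eq_of_sign_cocycle h.admissible.irrational hu
    (abs_arcSign (lengthJ α n)) hcob
  set y : UnitAddCircle := (xInfty α n : UnitAddCircle) with hy
  have h1 := h.ae_eq_zero_of_cocycleSign (u := fun x => u x * u (x - y))
    (hu.mul (hu.comp (measurable_id.sub_const y))) fun x => by
      rw [hcob x, hcob (x - y), cocycleSign, sub_right_comm x y]
      ring
  have h2 := (measurePreserving_sub_right (volume : Measure UnitAddCircle)
    y).quasiMeasurePreserving.ae hc
  obtain ⟨x, hx1, hx2, hx3⟩ := (h1.and (hc.and h2)).exists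
  have hc0 : c = 0 := by
    have h3 : |u x| * |u (x - y)| = 0 := by rw [← abs_mul, hx1, abs_zero]
    rw [hx2, hx3] at h3
    exact mul_self_eq_zero.1 h3
  exact hc.mono fun x hx => abs_eq_zero.1 (hx.trans hc0)

theorem ae_eq_zero_of_arcSign_translate (h : AdmissibleData α n a q p) (hu : Measurable u)
    (hcob : ∀ x, u x = arcSign (lengthJ α n) (x - (xInfty α n : UnitAddCircle)) *
      u (x - (α : UnitAddCircle))) :
    ∀ᵐ x, u x = 0 := by
  set y : UnitAddCircle := (xInfty α n : UnitAddCircle) with hy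
  have h1 := h.ae_eq_zero_of_arcSign (u := fun x => u (x + y))
    (hu.comp (measurable_add_const y)) fun x => by
      rw [hcob (x + y), add_sub_cancel_right, add_sub_right_comm]
  have h2 := (measurePreserving_sub_right (volume : Measure UnitAddCircle)
    y).quasiMeasurePreserving.ae h1
  simpa using h2

end AdmissibleData

/-! ### Ergodicity of the skew product -/

/-- The nontrivial character of `ℤ/2ℤ`. -/
noncomputable def signChar (i : ZMod 2) : ℝ := if i = 0 then 1 else -1

theorem signChar_add (i j : ZMod 2) : signChar (i + j) = signChar i * signChar j := by
  have hij : ∀ k : ZMod 2, k = 0 ∨ k = 1 := by decide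
  have h : (1 : ZMod 2) + 1 = 0 := rfl
  rcases hij i with rfl | rfl <;> rcases hij j with rfl | rfl <;> simp [signChar, h]

open Classical in
theorem signChar_indicator (S : Set UnitAddCircle) (x : UnitAddCircle) :
    signChar (S.indicator (fun _ => 1) x) = if x ∈ S then -1 else 1 := by
  by_cases hx : x ∈ S <;> simp [signChar, hx]

theorem signChar_intervalJ (α : ℝ) (n : ℕ → ℕ) (x : UnitAddCircle) :
    signChar ((intervalJ α n).indicator (fun _ => 1) x) = arcSign (lengthJ α n) x := by
  rw [signChar_indicator]
  rfl

theorem mem_intervalJTranslate {α : ℝ} {n : ℕ → ℕ} {x : UnitAddCircle} :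
    x ∈ intervalJTranslate α n ↔ x - (xInfty α n : UnitAddCircle) ∈ intervalJ α n := by
  rw [intervalJTranslate, Set.mem_image]
  exact ⟨by rintro ⟨y, hy, rfl⟩; simpa using hy, fun hx => ⟨_, hx, sub_add_cancel _ _⟩⟩

theorem signChar_intervalJTranslate (α : ℝ) (n : ℕ → ℕ) (x : UnitAddCircle) :
    signChar ((intervalJTranslate α n).indicator (fun _ => 1) x) =
      arcSign (lengthJ α n) (x - (xInfty α n : UnitAddCircle)) := by
  classical
  rw [signChar_indicator, arcSign]
  simp only [mem_intervalJTranslate, intervalJ]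

/-- The cocycle of the skew product, with values in `ℤ/2ℤ × ℤ/2ℤ`. -/
noncomputable def skewCocycle (α : ℝ) (n : ℕ → ℕ) (x : UnitAddCircle) : ZMod 2 × ZMod 2 :=
  ((intervalJ α n).indicator (fun _ => 1) x, (intervalJTranslate α n).indicator (fun _ => 1) x)

theorem hatT_apply (α : ℝ) (n : ℕ → ℕ) (x : UnitAddCircle) (g : ZMod 2 × ZMod 2) :
    hatT α n (x, g) =
      (x + (α : UnitAddCircle), g + skewCocycle α n (x + (α : UnitAddCircle))) := rfl

theorem measurable_skewCocycle (α : ℝ) (n : ℕ → ℕ) : Measurable (skewCocycle α n) := by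
  have h1 : MeasurableSet (intervalJ α n) := measurableSet_arc _
  have h2 : MeasurableSet (intervalJTranslate α n) := by
    have : intervalJTranslate α n = (fun x => x - (xInfty α n : UnitAddCircle)) ⁻¹' intervalJ α n :=
      Set.ext fun x => mem_intervalJTranslate
    rw [this]
    exact h1.preimage (measurable_id.sub_const _)
  exact (measurable_const.indicator h1).prodMk (measurable_const.indicator h2)

/-- The product of the Haar measure on the circle and the uniform measure on the fibre. -/
noncomputable def skewMeasure : Measure (UnitAddCircle × ZMod 2 × ZMod 2) :=
  volume.prod ((4 : ENNReal)⁻¹ • Measure.count)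

instance isProbabilityMeasure_fibre :
    IsProbabilityMeasure ((4 : ENNReal)⁻¹ • (Measure.count : Measure (ZMod 2 × ZMod 2))) := by
  constructor
  rw [Measure.smul_apply, Measure.count_apply_finite _ Set.finite_univ]
  have : (Set.finite_univ (α := ZMod 2 × ZMod 2)).toFinset.card = 4 := by
    rw [Set.Finite.toFinset_univ]; rfl
  rw [this, smul_eq_mul]
  exact ENNReal.inv_mul_cancel (by norm_num) (by norm_num)

instance isProbabilityMeasure_skewMeasure : IsProbabilityMeasure skewMeasure := by
  unfold skewMeasure; infer_instance

theorem measurePreserving_hatT (α : ℝ) (n : ℕ → ℕ) :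
    MeasurePreserving (hatT α n) skewMeasure skewMeasure := by
  refine MeasurePreserving.skew_product
    (g := fun x (g : ZMod 2 × ZMod 2) => g + skewCocycle α n (x + (α : UnitAddCircle)))
    (measurePreserving_add_right volume (α : UnitAddCircle)) ?_ (ae_of_all _ fun x => ?_)
  · exact measurable_snd.add
      (((measurable_skewCocycle α n).comp (measurable_add_const _)).comp measurable_fst)
  · rw [Measure.map_smul]
    congr 1
    ext s hs
    rw [Measure.map_apply (measurable_add_const _) hs]
    have e := Set.image_add_right (b := -skewCocycle α n (x + (α : UnitAddCircle))) (t := s)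
    rw [neg_neg] at e
    rw [← e]
    exact Measure.count_injective_image (add_left_injective _) s

/-- The Fourier coefficient, with respect to the fibre, of the indicator function of `A`. -/
noncomputable def fibreCoeff (χ : ZMod 2 × ZMod 2 → ℝ) (A : Set (UnitAddCircle × ZMod 2 × ZMod 2))
    (x : UnitAddCircle) : ℝ :=
  ∑ g, χ g * A.indicator (fun _ => (1 : ℝ)) (x, g)

theorem measurable_fibreCoeff (χ : ZMod 2 × ZMod 2 → ℝ)
    {A : Set (UnitAddCircle × ZMod 2 × ZMod 2)} (hA : MeasurableSet A) :
    Measurable (fibreCoeff χ A) :=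
  Finset.measurable_sum _ fun _ _ => measurable_const.mul
    ((measurable_const.indicator hA).comp (measurable_id.prodMk measurable_const))

theorem fibreCoeff_eq {α : ℝ} {n : ℕ → ℕ} {χ : ZMod 2 × ZMod 2 → ℝ}
    (hχ : ∀ g g', χ (g + g') = χ g * χ g') {A : Set (UnitAddCircle × ZMod 2 × ZMod 2)}
    (hA : hatT α n ⁻¹' A = A) (x : UnitAddCircle) :
    fibreCoeff χ A x = χ (skewCocycle α n x) * fibreCoeff χ A (x - (α : UnitAddCircle)) := by
  rw [fibreCoeff, fibreCoeff, Finset.mul_sum, ← Equiv.sum_comp (Equiv.addRight (skewCocycle α n x))]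
  refine Finset.sum_congr rfl fun g _ => ?_
  have h1 : A.indicator (fun _ => (1 : ℝ)) (x - (α : UnitAddCircle), g) =
      A.indicator (fun _ => (1 : ℝ)) (x, g + skewCocycle α n x) := by
    have h2 : (x - (α : UnitAddCircle), g) ∈ A ↔ (x, g + skewCocycle α n x) ∈ A := by
      conv_lhs => rw [← hA, Set.mem_preimage, hatT_apply, sub_add_cancel]
    by_cases h3 : (x, g + skewCocycle α n x) ∈ A
    · rw [Set.indicator_of_mem h3, Set.indicator_of_mem (h2.2 h3)]
    · rw [Set.indicator_of_notMem h3, Set.indicator_of_notMem (mt h2.1 h3)]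
  rw [h1, Equiv.coe_addRight, hχ]
  ring

/-- Fourier inversion on `ℤ/2ℤ × ℤ/2ℤ`. -/
theorem four_mul_indicator_eq (A : Set (UnitAddCircle × ZMod 2 × ZMod 2)) (x : UnitAddCircle)
    (i j : ZMod 2) : 4 * A.indicator (fun _ => (1 : ℝ)) (x, i, j) =
      fibreCoeff (fun _ => 1) A x + signChar i * fibreCoeff (fun g => signChar g.1) A x +
      signChar j * fibreCoeff (fun g => signChar g.2) A x +
      signChar i * signChar j * fibreCoeff (fun g => signChar g.1 * signChar g.2) A x := by
  have hsum : ∀ f : ZMod 2 → ℝ, ∑ k, f k = f 0 + f 1 := fun f => Fin.sum_univ_two f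
  simp only [fibreCoeff, Fintype.sum_prod_type, hsum]
  have h0 : signChar 0 = 1 := by simp [signChar]
  have h1 : signChar 1 = -1 := by simp [signChar]
  have hij : ∀ k : ZMod 2, k = 0 ∨ k = 1 := by decide
  rcases hij i with rfl | rfl <;> rcases hij j with rfl | rfl <;> simp only [h0, h1] <;> ring

theorem ergodic_hatT {α : ℝ} {n : ℕ → ℕ} (h : IsAdmissible α n) :
    Ergodic (hatT α n) skewMeasure := by
  obtain ⟨a, q, p, hd⟩ := exists_contFractData h.irrational
  have hD : AdmissibleData α n a q p := ⟨hd, h⟩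
  refine ⟨measurePreserving_hatT α n, ⟨fun A hA hinv => ?_⟩⟩
  have k1 := hD.ae_eq_zero_of_arcSign (measurable_fibreCoeff (fun g => signChar g.1) hA) fun x => by
    rw [← signChar_intervalJ]
    exact fibreCoeff_eq (fun _ _ => signChar_add _ _) hinv x
  have k2 := hD.ae_eq_zero_of_arcSign_translate
    (measurable_fibreCoeff (fun g => signChar g.2) hA) fun x => by
      rw [← signChar_intervalJTranslate]
      exact fibreCoeff_eq (fun _ _ => signChar_add _ _) hinv x
  have k3 := hD.ae_eq_zero_of_cocycleSign
    (measurable_fibreCoeff (fun g => signChar g.1 * signChar g.2) hA) fun x => by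
      rw [cocycleSign, ← signChar_intervalJ, ← signChar_intervalJTranslate]
      exact fibreCoeff_eq (χ := fun g => signChar g.1 * signChar g.2) (fun g g' => by
        simp only [Prod.fst_add, Prod.snd_add, signChar_add]; ring) hinv x
  obtain ⟨c, hc⟩ := (ergodic_rotation h.irrational).ae_eq_const_of_ae_eq_comp_ae
    (g := fibreCoeff (fun _ => 1) A) (measurable_fibreCoeff _ hA).aestronglyMeasurable
    (ae_of_all _ fun x => by
      have := fibreCoeff_eq (χ := fun _ => 1) (by simp) hinv (x + (α : UnitAddCircle))
      rwa [add_sub_cancel_right, one_mul] at this)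
  have hall : ∀ᵐ x : UnitAddCircle, ∀ g : ZMod 2 × ZMod 2,
      A.indicator (fun _ => (1 : ℝ)) (x, g) = c / 4 := by
    filter_upwards [k1, k2, k3, hc] with x h1 h2 h3 h4 g
    have := four_mul_indicator_eq A x g.1 g.2
    rw [h1, h2, h3, h4] at this
    simp only [Function.const, mul_zero, add_zero] at this
    linarith
  have hall' : ∀ᵐ z ∂skewMeasure, A.indicator (fun _ => (1 : ℝ)) z = c / 4 :=
    (Measure.quasiMeasurePreserving_fst.ae hall).mono fun z hz => hz z.2
  rw [eventuallyConst_set]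
  by_cases hc1 : c / 4 = 1
  · left
    filter_upwards [hall'] with z hz
    by_contra hzA
    rw [Set.indicator_of_notMem hzA, hc1] at hz
    exact zero_ne_one hz
  · right
    filter_upwards [hall'] with z hz hzA
    rw [Set.indicator_of_mem hzA] at hz
    exact hc1 hz.symm

/-! ### Invariant measures -/

/-- Invariance under an irrational rotation passes to all rotations by continuity. -/
theorem eq_volume_of_rotation_invariant {α : ℝ} (hα : Irrational α) (ρ : Measure UnitAddCircle)
    [IsProbabilityMeasure ρ]
    (hρ : MeasurePreserving (fun x => x + (α : UnitAddCircle)) ρ ρ) : ρ = volume := by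
  have hdense : DenseRange (fun k : ℤ => k • (α : UnitAddCircle)) := by
    rw [AddCircle.denseRange_zsmul_coe_iff]
    simpa using hα
  have hz : ∀ k : ℤ, ∀ f : UnitAddCircle → ℝ, ∫ x, f (x + k • (α : UnitAddCircle)) ∂ρ = ∫ x, f x ∂ρ := by
    have h1 : ∀ f : UnitAddCircle → ℝ, ∫ x, f (x + (α : UnitAddCircle)) ∂ρ = ∫ x, f x ∂ρ := fun f =>
      hρ.integral_comp (MeasurableEquiv.addRight (α : UnitAddCircle)).measurableEmbedding f
    intro k
    induction k with
    | zero => simp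
    | succ k ih =>
      intro f
      rw [← ih f, ← h1 fun x => f (x + (k : ℤ) • (α : UnitAddCircle))]
      simp only [add_smul, one_smul, add_assoc, add_comm (α : UnitAddCircle)]
    | pred k ih =>
      intro f
      rw [← ih f, ← h1 fun x => f (x + (-(k : ℤ) - 1) • (α : UnitAddCircle))]
      simp only [sub_smul, one_smul, add_assoc, add_sub_cancel]
  -- Both sides are continuous in `t` and agree on the dense orbit.
  have hinv : ∀ t : UnitAddCircle, ∀ f : BoundedContinuousFunction UnitAddCircle ℝ,
      ∫ x, f (x + t) ∂ρ = ∫ x, f x ∂ρ := by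
    intro t f
    have hcont : Continuous fun t : UnitAddCircle => ∫ x, f (x + t) ∂ρ := by
      refine continuous_of_dominated (bound := fun _ => ‖f‖) (fun t => ?_)
        (fun t => ae_of_all _ fun x => f.norm_coe_le_norm _) (integrable_const _)
        (ae_of_all _ fun x => by fun_prop)
      exact (by fun_prop : Continuous fun x => f (x + t)).aestronglyMeasurable
    exact congrFun (hdense.equalizer hcont continuous_const (funext fun k => hz k f)) t
  have : ρ.IsAddLeftInvariant := by
    refine ⟨fun t => ?_⟩
    have : IsProbabilityMeasure (ρ.map (t + ·)) :=
      Measure.isProbabilityMeasure_map (measurable_const_add t).aemeasurable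
    refine ext_of_forall_integral_eq_of_IsFiniteMeasure fun f => ?_
    rw [integral_map (measurable_const_add t).aemeasurable f.continuous.aestronglyMeasurable]
    simpa only [add_comm t] using hinv t f
  have : ρ.IsAddHaarMeasure := Measure.isAddHaarMeasure_of_isCompact_nonempty_interior ρ Set.univ
    isCompact_univ (by simp) (by simp) (by simp)
  exact Measure.isAddHaarMeasure_eq_of_isProbabilityMeasure _ _

/-- Invariant measures project to Haar measure on the circle, and the fibre is finite. -/
theorem absolutelyContinuous_skewMeasure {α : ℝ} {n : ℕ → ℕ} (hα : Irrational α)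
    {μ : Measure (UnitAddCircle × ZMod 2 × ZMod 2)} [IsProbabilityMeasure μ]
    (hμ : MeasurePreserving (hatT α n) μ μ) : μ ≪ skewMeasure := by
  have hprob : IsProbabilityMeasure (μ.map Prod.fst) :=
    Measure.isProbabilityMeasure_map measurable_fst.aemeasurable
  have hfst : MeasurePreserving Prod.fst μ (μ.map Prod.fst) := measurable_fst.measurePreserving μ
  have hmap : μ.map Prod.fst = volume := by
    refine eq_volume_of_rotation_invariant hα _ ⟨measurable_add_const _, ?_⟩
    rw [Measure.map_map (measurable_add_const _) measurable_fst]
    exact (hfst.comp hμ).map_eq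
  rw [hmap] at hfst
  refine Measure.AbsolutelyContinuous.mk fun s hs hs0 => ?_
  rw [skewMeasure, Measure.measure_prod_null hs] at hs0
  have h1 : ∀ᵐ x : UnitAddCircle, ∀ g : ZMod 2 × ZMod 2, (x, g) ∉ s := by
    filter_upwards [hs0] with x hx g hg
    rw [Pi.zero_apply, Measure.smul_apply, smul_eq_mul, mul_eq_zero, Measure.count_eq_zero_iff] at hx
    rcases hx with hx | hx
    · norm_num at hx
    · exact Set.eq_empty_iff_forall_notMem.1 hx g hg
  exact measure_eq_zero_iff_ae_notMem.2
    ((hfst.quasiMeasurePreserving.ae h1).mono fun z hz => hz z.2)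

theorem theorem9p5 (α : ℝ) (n : ℕ → ℕ) (h : IsAdmissible α n) :
    IsUniquelyErgodic (hatT α n) := by
  refine ⟨skewMeasure, ⟨inferInstance, measurePreserving_hatT α n⟩, fun μ ⟨hprob, hμ⟩ => ?_⟩
  exact (ergodic_hatT h).eq_of_absolutelyContinuous hμ
    (absolutelyContinuous_skewMeasure h.irrational hμ)
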